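/- Let $R$ be a right Artinian ring with centre $C$ such that every residue field $C/\mathfrak m$ ($\mathfrak m$ a maximal ideal of $C$) has at least seven elements, and let $n\ge 0$. Let $L$ be the lattice of right submodules of the free right module $R^n$ of columns, on which $G=\mathrm{GL}(n,R)$ acts by $g(N)=\{gx : x\in N\}$, and let $L_0$ be the sublattice of $L$ generated by $e_1R,\dots,e_nR$, where $e_1,\dots,e_n$ is the standard basis. For a subgroup $F\le G$ and a sublattice $M$ of $L$ put $L(F)=\{l\in L : f(l)=l \text{ for all } f\in F\}$ and $G(M)=\{g\in G : g(m)=m\text{ for all } m\in M\}$. Let $H=G(L_0)$ and $L_0'=L(H)$, and put $L_0'(F)=L_0'\cap L(F)$. Call sublattices $M_1,M_2$ of $L_0'$ equivalent if $G(M_1)=G(M_2)$. Call a subgroup $F$ with $H\le F\le G$ closed if $G(L_0'(F))=F$, and a sublattice $M$ of $L_0'$ closed if $L_0'(G(M))=M$. A $D$-net of order $n$ over $R$ is a family $\sigma=(\sigma_{ij})_{1\le i,j\le n}$ of two-sided ideals of $R$ with $\sigma_{ik}\sigma_{kj}\subseteq\sigma_{ij}$ and $\sigma_{ii}=R$ for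 all $i,j,k$; its net subgroup $G(\sigma)$ is the largest subgroup of $G$ all of whose elements $g$ satisfy $g_{ij}\in\sigma_{ij}$ for all $i,j$. For $x\in L$ let $x_j\subseteq R$ be the image of $x$ under the $j$-th coordinate projection, and let $L_0'(\sigma)=\{x\in L_0' : \sigma_{ij}x_j\subseteq x_i \text{ for all } i,j\}$. Then: 1. For every subgroup $F$ with $D(n,R)\le F\le \mathrm{GL}(n,R)$, where $D(n,R)$ is the group of invertible diagonal matrices, there is exactly one equivalence class of sublattices of $L_0'$ such that $G(M)$ is a normal subgroup of $F$ (in particular $G(M)\le F$) for every $M$ in the class. 2. The closed subgroups are exactly the net subgroups $G(\sigma)$, $\sigma$ a $D$-net of order $n$ over $R$. 3. The closed sublattices of $L_0'$ are exactly the sets $L_0'(\sigma)$, $\sigma$ a $D$-net of order $n$ over $R$. -/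

import Mathlib

namespace LatticeGalois

open Matrix

section Abstract

/-! Galois correspondence for a group `G` acting on a lattice `L` through `ρ`. -/

variable {G L : Type*} [Group G] [Lattice L] (ρ : G →* (L ≃o L))

/-- `L(F)`: the sublattice of the elements of `L` fixed by every element of `F`. -/
def fixedLattice (F : Subgroup G) : Sublattice L where
  carrier := {l | ∀ f ∈ F, ρ f l = l}
  supClosed' := by
    intro a ha b hb f hf
    rw [map_sup, ha f hf, hb f hf]
  infClosed' := by
    intro a ha b hb f hf
    rw [map_inf, ha f hf, hb f hf]

/-- `G(M)`: the subgroup of the elements of `G` fixing every element of `M`. -/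
def fixingGroup (M : Sublattice L) : Subgroup G where
  carrier := {g | ∀ m ∈ M, ρ g m = m}
  one_mem' := by
    intro m _
    simp
  mul_mem' := by
    intro a b ha hb m hm
    rw [map_mul, RelIso.mul_apply, hb m hm, ha m hm]
  inv_mem' := by
    intro a ha m hm
    have h : ρ a⁻¹ (ρ a m) = m := by
      rw [← RelIso.mul_apply, ← map_mul, inv_mul_cancel, map_one, RelIso.one_apply]
    rwa [ha m hm] at h

variable (L₀ : Sublattice L)

/-- `L₀' = L(H)`, where `H = G(L₀)`. -/
def primeLattice : Sublattice L := fixedLattice ρ (fixingGroup ρ L₀)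

/-- The set of sublattices of `L₀'`. -/
abbrev SublatticesOfPrime : Type _ := {M : Sublattice L // M ≤ primeLattice ρ L₀}

/-- `L₀'(F)`: the elements of `L₀'` fixed by every element of `F`. -/
def primeFixed (F : Subgroup G) : Sublattice L := primeLattice ρ L₀ ⊓ fixedLattice ρ F

/-- `F` is a closed element of the set of subgroups of `G` containing `H = G(L₀)`. -/
def IsClosedSubgroup (F : Subgroup G) : Prop :=
  fixingGroup ρ L₀ ≤ F ∧ fixingGroup ρ (primeFixed ρ L₀ F) = F

/-- `M` is a closed element of the set of sublattices of `L₀'`. -/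
def IsClosedSublattice (M : Sublattice L) : Prop :=
  M ≤ primeLattice ρ L₀ ∧ primeFixed ρ L₀ (fixingGroup ρ M) = M

/-- Sublattices `M₁`, `M₂` of `L₀'` are equivalent if `G(M₁) = G(M₂)`. -/
def equivSetoid : Setoid (SublatticesOfPrime ρ L₀) where
  r M₁ M₂ := fixingGroup ρ M₁.1 = fixingGroup ρ M₂.1
  iseqv := ⟨fun _ => rfl, fun h => h.symm, fun h₁ h₂ => h₁.trans h₂⟩

/-- `N ⊴ F`: `N` is contained in `F` and is normal in it. -/
def IsNormalIn (N F : Subgroup G) : Prop := N ≤ F ∧ (N.subgroupOf F).Normal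

end Abstract

section Linear

variable (n : ℕ) (R : Type*) [Ring R]

/-- The lattice of right submodules of the free right module `Rⁿ` of columns. -/
abbrev RightSubmodules : Type _ := Submodule Rᵐᵒᵖ (Fin n → R)

variable {n R}

/-- Multiplication of columns by an invertible matrix on the left, a right linear automorphism. -/
def colEquiv (g : GL (Fin n) R) : (Fin n → R) ≃ₗ[Rᵐᵒᵖ] (Fin n → R) where
  toFun v := g.1 *ᵥ v
  map_add' v w := Matrix.mulVec_add _ v w
  map_smul' r v := Matrix.mulVec_smul _ r v
  invFun v := (g⁻¹).1 *ᵥ v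
  left_inv v := by simp [Matrix.mulVec_mulVec]
  right_inv v := by simp [Matrix.mulVec_mulVec]

variable (n R)

/-- The action of `GL(n, R)` on right submodules: `g(N) = {g x : x ∈ N}`. -/
def glAction : GL (Fin n) R →* (RightSubmodules n R ≃o RightSubmodules n R) where
  toFun g := Submodule.orderIsoMapComap (colEquiv g)
  map_one' := by
    ext N x
    simp [colEquiv, Submodule.mem_map]
  map_mul' g h := by
    ext N x
    simp [colEquiv, Submodule.mem_map, Matrix.mulVec_mulVec]

/-- The sublattice `L₀` generated by the coordinate submodules `e₁R, …, eₙR`. -/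
def coordLattice : Sublattice (RightSubmodules n R) :=
  sInf {K | ∀ i : Fin n, Submodule.span Rᵐᵒᵖ {(Pi.single i 1 : Fin n → R)} ∈ K}

/-- `D(n, R)`: the subgroup of invertible diagonal matrices. -/
def diagGroup : Subgroup (GL (Fin n) R) :=
  (Units.map (Matrix.diagonalRingHom (Fin n) R).toMonoidHom).range

/-- A `D`-net of order `n` over `R`: a square table of two-sided ideals with
`σᵢₖ σₖⱼ ⊆ σᵢⱼ` and `σᵢᵢ = R`. -/
structure DNet where
  ideal : Fin n → Fin n → TwoSidedIdeal R
  mul_mem : ∀ i k j, ∀ a ∈ ideal i k, ∀ b ∈ ideal k j, a * b ∈ ideal i j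
  diag : ∀ i, ideal i i = ⊤

variable {n R}

/-- The net subgroup `G(σ)`: the largest subgroup of `GL(n, R)` all of whose elements `g`
satisfy `gᵢⱼ ∈ σᵢⱼ` for all `i, j`. -/
def DNet.group (σ : DNet n R) : Subgroup (GL (Fin n) R) where
  carrier := {g | (∀ i j, g.1 i j ∈ σ.ideal i j) ∧ ∀ i j, (g⁻¹).1 i j ∈ σ.ideal i j}
  one_mem' := by
    have h : ∀ i j, (1 : Matrix (Fin n) (Fin n) R) i j ∈ σ.ideal i j := by
      intro i j
      by_cases hij : i = j
      · subst hij
        rw [σ.diag]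
        trivial
      · rw [Matrix.one_apply_ne hij]
        exact zero_mem _
    exact ⟨h, by simpa using h⟩
  mul_mem' := by
    have key : ∀ A B : Matrix (Fin n) (Fin n) R, (∀ i j, A i j ∈ σ.ideal i j) →
        (∀ i j, B i j ∈ σ.ideal i j) → ∀ i j, (A * B) i j ∈ σ.ideal i j := by
      intro A B hA hB i j
      rw [Matrix.mul_apply]
      exact sum_mem fun k _ => σ.mul_mem i k j _ (hA i k) _ (hB k j)
    intro a b ha hb
    refine ⟨key _ _ ha.1 hb.1, ?_⟩
    rw [_root_.mul_inv_rev]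
    exact key _ _ hb.2 ha.2
  inv_mem' := by
    intro a ha
    exact ⟨ha.2, by simpa using ha.1⟩

/-- The `j`-th component `xⱼ` of the support of a right submodule `x` of `Rⁿ`, regarded as a
right ideal of `R`: the least right ideals with `x ⊆ e₁x₁ + ⋯ + eₙxₙ` are the projections. -/
def component (x : RightSubmodules n R) (j : Fin n) : Submodule Rᵐᵒᵖ R :=
  x.map (LinearMap.proj j : (Fin n → R) →ₗ[Rᵐᵒᵖ] R)

/-- `L₀'(σ)`: the elements `x` of `L₀'` with `σᵢⱼ xⱼ ⊆ xᵢ` for all `i, j`. -/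
def DNet.lattice (σ : DNet n R) : Set (RightSubmodules n R) :=
  {x | x ∈ primeLattice (glAction n R) (coordLattice n R) ∧
    ∀ i j, ∀ a ∈ σ.ideal i j, ∀ b ∈ component x j, a * b ∈ component x i}

end Linear

end LatticeGalois

set_option linter.unusedSimpArgs false

/-! Parts 2 and 3 are formal once `R` has two properties: it is additively generated by its units,
and it has units `u` and `u - 1`. The second makes every submodule `x` stable under `D(n, R)` the
direct sum of its components `xᵢ`; the first makes these components two-sided ideals. For a family
of such `x`, the multipliers `a` with `a xⱼ ⊆ xᵢ` form a `D`-net whose net subgroup is the fixing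
group. Conversely, the columns of a net `σ` are fixed by `G(σ)` and recover `σ`. Hence the groups
`G(M)` are exactly the net subgroups.

Part 1 thus asks for a unique net subgroup normal in `F`. The only candidate is `G(σ)`, where `σᵢⱼ`
consists of the `a` with `1 + a Eᵢⱼ ∈ F`. Indeed, if `G(τ)` is normal in `F`, conjugating a diagonal
matrix of `G(τ)` by such a transvection puts `(u - 1) a` into `τᵢⱼ`.

Existence is the hard half: `G(σ) ≤ F` and `F` normalizes `G(σ)`. As `R` is right Artinian, `1` is a
sum of orthogonal idempotents `e_s` in whose corner rings every element is nilpotent or invertible.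
The proof works in the matrix ring with the idempotents `e_s Eᵢᵢ`, so that every diagonal corner is
local. The residue field hypothesis supplies central scalars `c` making several elements `c x + y`
of a corner invertible at once.

Gauss elimination, with pivots available because corners are local, gives `G(σ) ≤ F`
(`mem_of_netEntries`). For normality the essential case is `a α a⁻¹` with `a` in `F` and `α` in one
diagonal corner (`one_add_conj_corner_mem`). A product of conjugates of diagonal elements is
arranged to differ from `1` only in one row and one column. From such an element, transvections are
extracted by commutators with diagonal elements and by comparing two scalars (`one_add_entry_mem`,
`one_add_mem_of_two_blocks`). -/

namespace LatticeGalois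

open Matrix

/-! ### Local corner rings and the choice of scalars. -/

section Frame

variable {C A : Type*} [CommRing C] [Ring A] [Algebra C A]

/-- `x ∈ e A e'`, for idempotents `e`, `e'`. -/
def Block (e e' x : A) : Prop := e * x = x ∧ x * e' = x

/-- `y` is the inverse of `x` in the corner ring `e A e`. -/
structure InvAt (e x y : A) : Prop where
  left : Block e e x
  right : Block e e y
  mul : x * y = e
  mul' : y * x = e

/-- `x` is invertible in the corner ring `e A e`. -/
def UnitAt (e x : A) : Prop := ∃ y, InvAt e x y

/-- `e` is an idempotent for which all elements of `e A e` are nilpotent or invertible, and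
the scalars in `C` have at least seven residue classes in `e A e`. -/
structure LocalIdem (C : Type*) {A : Type*} [CommRing C] [Ring A] [Algebra C A] (e : A) : Prop where
  idem : e * e = e
  dichotomy : ∀ x, Block e e x → IsNilpotent x ∨ UnitAt e x
  large : ∃ T : Finset C, 7 ≤ T.card ∧
    ∀ s ∈ T, ∀ t ∈ T, s ≠ t → ¬ IsNilpotent ((s - t) • e)

theorem mul_assoc_of_eq {a b c : A} (h : a * b = c) (z : A) : a * (b * z) = c * z := by
  rw [← mul_assoc, h]

namespace Block

variable {e e' e'' x y : A}

theorem add (hx : Block e e' x) (hy : Block e e' y) : Block e e' (x + y) :=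
  ⟨by rw [mul_add, hx.1, hy.1], by rw [add_mul, hx.2, hy.2]⟩

theorem neg (hx : Block e e' x) : Block e e' (-x) :=
  ⟨by rw [mul_neg, hx.1], by rw [neg_mul, hx.2]⟩

theorem sub (hx : Block e e' x) (hy : Block e e' y) : Block e e' (x - y) :=
  sub_eq_add_neg x y ▸ hx.add hy.neg

theorem zero : Block e e' (0 : A) := ⟨mul_zero _, zero_mul _⟩

theorem smul (c : C) (hx : Block e e' x) : Block e e' (c • x) :=
  ⟨by rw [mul_smul_comm, hx.1], by rw [smul_mul_assoc, hx.2]⟩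

theorem mul (hx : Block e e' x) (hy : Block e' e'' y) : Block e e'' (x * y) :=
  ⟨by rw [← mul_assoc, hx.1], by rw [mul_assoc, hy.2]⟩

theorem self (he : e * e = e) : Block e e e := ⟨he, he⟩

theorem mk' (he : e * e = e) (he' : e' * e' = e') (x : A) : Block e e' (e * x * e') :=
  ⟨by rw [← mul_assoc, ← mul_assoc, he], by rw [mul_assoc, he']⟩

theorem mul_eq_zero {g g' : A} (hx : Block e e' x) (hy : Block g g' y) (h : e' * g = 0) :
    x * y = 0 := by
  rw [← hx.2, ← hy.1, mul_assoc, ← mul_assoc e', h, zero_mul, mul_zero]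

theorem mul_left_zero {g : A} (hx : Block e e' x) (h : g * e = 0) : g * x = 0 := by
  rw [← hx.1, ← mul_assoc, h, zero_mul]

theorem mul_right_zero {g : A} (hx : Block e e' x) (h : e' * g = 0) : x * g = 0 := by
  rw [← hx.2, mul_assoc, h, mul_zero]

end Block

theorem InvAt.symm {e x y : A} (h : InvAt e x y) : InvAt e y x := ⟨h.right, h.left, h.mul', h.mul⟩

theorem UnitAt.mul {e x y : A} (hx : UnitAt e x) (hy : UnitAt e y) : UnitAt e (x * y) := by
  obtain ⟨x', hx⟩ := hx
  obtain ⟨y', hy⟩ := hy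
  refine ⟨y' * x', hx.left.mul hy.left, hy.right.mul hx.right, ?_, ?_⟩
  · rw [mul_assoc, mul_assoc_of_eq hy.mul, hx.right.1, hx.mul]
  · rw [mul_assoc, mul_assoc_of_eq hx.mul', hy.left.1, hy.mul']

theorem UnitAt.of_mul_eq {e x y z : A} (hx : Block e e x) (hy : Block e e y) (hz : Block e e z)
    (hxy : x * y = e) (hzx : z * x = e) : UnitAt e x := by
  have : z = y := by rw [← hz.2, ← hxy, ← mul_assoc, hzx, hy.1]
  exact ⟨y, hx, hy, hxy, this ▸ hzx⟩

theorem UnitAt.neg {e x : A} (hx : UnitAt e x) : UnitAt e (-x) := by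
  obtain ⟨y, h⟩ := hx
  exact ⟨-y, h.left.neg, h.right.neg, by rw [neg_mul_neg, h.mul], by rw [neg_mul_neg, h.mul']⟩

theorem UnitAt.not_isNilpotent {e x : A} (hx : UnitAt e x) (he : ¬ IsNilpotent e) :
    ¬ IsNilpotent x := by
  obtain ⟨y, h⟩ := hx
  have : Commute x y := h.mul.trans h.mul'.symm
  exact fun hn => he (h.mul ▸ this.isNilpotent_mul_right hn)

namespace LocalIdem

variable {e : A} (he : LocalIdem C e)
include he

theorem not_isNilpotent : ¬ IsNilpotent e := by
  obtain ⟨T, hT, h⟩ := he.large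
  obtain ⟨s, hs, t, ht, hst⟩ := Finset.one_lt_card.1 (by omega : 1 < T.card)
  intro hn
  exact h s hs t ht hst (hn.smul _)

theorem unitAt_sub_of_isNilpotent {x : A} (hx : Block e e x) (hn : IsNilpotent x) :
    UnitAt e (e - x) := by
  refine (he.dichotomy _ ((Block.self he.idem).sub hx)).resolve_left fun h => ?_
  have : Commute (e - x) x := by
    rw [Commute, SemiconjBy, sub_mul, mul_sub, hx.1, hx.2]
  exact he.not_isNilpotent (by simpa using this.isNilpotent_add h hn)

/-- The non-units of the corner ring are closed under addition. -/
theorem unitAt_or_of_add {x y : A} (hx : Block e e x) (hy : Block e e y)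
    (h : UnitAt e (x + y)) : UnitAt e x ∨ UnitAt e y := by
  obtain ⟨u, hu⟩ := h
  rcases he.dichotomy _ (hu.right.mul hx) with hn | hx'
  · right
    have h1 := he.unitAt_sub_of_isNilpotent (hu.right.mul hx) hn
    have h2 : e - u * x = u * y := by
      rw [← hu.mul', mul_add, add_sub_cancel_left]
    rw [h2] at h1
    have h3 := UnitAt.mul ⟨_, hu⟩ h1
    rwa [← mul_assoc, hu.mul, hy.1] at h3
  · left
    have h3 := UnitAt.mul ⟨_, hu⟩ hx'
    rwa [← mul_assoc, hu.mul, hx.1] at h3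

theorem unitAt_self : UnitAt e e :=
  ⟨e, Block.self he.idem, Block.self he.idem, he.idem, he.idem⟩

theorem exists_unitAt_of_sum {ι : Type*} (s : Finset ι) (x : ι → A)
    (hx : ∀ i ∈ s, Block e e (x i)) (h : UnitAt e (∑ i ∈ s, x i)) : ∃ i ∈ s, UnitAt e (x i) := by
  classical
  induction s using Finset.induction_on with
  | empty =>
    rw [Finset.sum_empty] at h
    exact absurd IsNilpotent.zero (h.not_isNilpotent he.not_isNilpotent)
  | insert a s ha ih =>
    rw [Finset.sum_insert ha] at h
    have hs : Block e e (∑ i ∈ s, x i) := by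
      refine Finset.sum_induction _ _ (fun _ _ => Block.add) Block.zero fun i hi => ?_
      exact hx i (Finset.mem_insert_of_mem hi)
    rcases he.unitAt_or_of_add (hx a (Finset.mem_insert_self _ _)) hs h with h' | h'
    · exact ⟨a, Finset.mem_insert_self _ _, h'⟩
    · obtain ⟨i, hi, hu⟩ := ih (fun i hi => hx i (Finset.mem_insert_of_mem hi)) h'
      exact ⟨i, Finset.mem_insert_of_mem hi, hu⟩

/-- A one-sided inverse in the corner ring is two-sided. -/
theorem unitAt_of_mul_eq {x y : A} (hx : Block e e x) (h : UnitAt e (x * y)) :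
    UnitAt e x := by
  rcases he.dichotomy _ hx with hn | hu
  · exfalso
    obtain ⟨z, hz⟩ := h
    obtain ⟨k, hk⟩ := hn
    have key : ∀ m, ∃ w, x ^ m * w = e := by
      intro m
      induction m with
      | zero => exact ⟨e, by simp⟩
      | succ m ih =>
        obtain ⟨w, hw⟩ := ih
        refine ⟨y * z * w * e, ?_⟩
        have : x * (y * z * w) = e * w := by rw [← hz.mul]; noncomm_ring
        rw [pow_succ, mul_assoc, ← mul_assoc x, this]
        rcases m with _ | m
        · rw [pow_zero, one_mul] at hw ⊢
          rw [hw, he.idem, he.idem]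
        · have h4 : x ^ (m + 1) * e = x ^ (m + 1) := by rw [pow_succ, mul_assoc, hx.2]
          rw [mul_assoc e, ← mul_assoc _ e, h4, ← mul_assoc, hw, he.idem]
    obtain ⟨w, hw⟩ := key k
    rw [hk, zero_mul] at hw
    exact he.not_isNilpotent (hw ▸ IsNilpotent.zero)
  · exact hu

/-- Each pair excludes at most one scalar of `T`: if `s x + y` and `t x + y` are both nilpotent,
then so is `(s - t) x`, hence `x` because `s - t` is invertible in the corner, and hence `y`. Thus
fewer than seven conditions leave a scalar of `T` available. -/
theorem exists_smul_add_unitAt {k : ℕ} (hk : k < 7) (x y : Fin k → A)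
    (hx : ∀ i, Block e e (x i)) (hy : ∀ i, Block e e (y i)) (hc : ∀ i, Commute (x i) (y i))
    (hn : ∀ i, IsNilpotent (x i) → ¬ IsNilpotent (y i)) :
    ∃ c : C, ∀ i, UnitAt e (c • x i + y i) := by
  classical
  obtain ⟨T, hT, h⟩ := he.large
  let bad : Fin k → Finset C := fun i => T.filter fun c => ¬ UnitAt e (c • x i + y i)
  have hbad : ∀ i, (bad i).card ≤ 1 := by
    intro i
    rw [Finset.card_le_one]
    intro s hs t ht
    simp only [bad, Finset.mem_filter] at hs ht
    by_contra hst
    have hB : ∀ c : C, ¬ UnitAt e (c • x i + y i) → IsNilpotent (c • x i + y i) := fun c hc' =>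
      (he.dichotomy _ (((hx i).smul c).add (hy i))).resolve_right hc'
    have c1 : ∀ c d : C, Commute (c • x i + y i) (d • x i + y i) := fun c d =>
      (((Commute.refl (x i)).smul_left c |>.smul_right d).add_right ((hc i).smul_left c)).add_left
        (((hc i).symm.smul_right d).add_right (Commute.refl _))
    have h1 : IsNilpotent ((s - t) • x i) := by
      have := (c1 s t).isNilpotent_sub (hB s hs.2) (hB t ht.2)
      rwa [add_sub_add_right_eq_sub, ← sub_smul] at this
    have hst' : UnitAt e ((s - t) • e) :=
      (he.dichotomy _ ((Block.self he.idem).smul _)).resolve_left (h s hs.1 t ht.1 hst)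
    obtain ⟨z, hz⟩ := hst'
    have hz' : (s - t) • z = e := by rw [← hz.mul', mul_smul_comm, hz.right.2]
    have h2 : IsNilpotent (x i) := by
      have h3 : x i = z * ((s - t) • x i) := by
        rw [mul_smul_comm, ← smul_mul_assoc, hz', (hx i).1]
      have hcz : Commute z ((s - t) • x i) := by
        rw [Commute, SemiconjBy, ← h3, smul_mul_assoc, ← mul_smul_comm, hz', (hx i).2]
      rw [h3]
      exact hcz.isNilpotent_mul_left h1
    have h4 : IsNilpotent (y i) := by
      have : Commute (s • x i + y i) (s • x i) :=
        ((Commute.refl (x i)).smul_left s |>.smul_right s).add_left ((hc i).symm.smul_right s)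
      simpa using this.isNilpotent_sub (hB s hs.2) (h2.smul s)
    exact hn i h2 h4
  have hcard : (Finset.univ.biUnion bad).card < T.card := by
    calc _ ≤ ∑ i : Fin k, (bad i).card := Finset.card_biUnion_le
      _ ≤ ∑ _i : Fin k, 1 := Finset.sum_le_sum fun i _ => hbad i
      _ < T.card := by simp; omega
  obtain ⟨c, hcT, hcb⟩ := Finset.exists_mem_notMem_of_card_lt_card hcard
  refine ⟨c, fun i => ?_⟩
  by_contra hu
  exact hcb (Finset.mem_biUnion.2 ⟨i, Finset.mem_univ _, Finset.mem_filter.2 ⟨hcT, hu⟩⟩)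

/-- A scalar invertible in a corner is invertible in every linked corner. -/
theorem unitAt_smul_of_block {g x : A} {c : C} (hx : Block g e x ∨ Block e g x) (hx0 : x ≠ 0)
    (hg : UnitAt g (c • g)) : UnitAt e (c • e) := by
  refine (he.dichotomy _ ((Block.self he.idem).smul c)).resolve_left fun hn => hx0 ?_
  obtain ⟨N, hN⟩ := hn
  obtain ⟨y, hy⟩ := hg
  have hy' : c • y = g := by rw [← hy.mul', mul_smul_comm, hy.right.2]
  -- Since `e` is idempotent, nilpotency of `c • e` means that a power of `c` kills `e`, hence also
  -- `x`; but `c` acts invertibly on `x` through `g`.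
  have hN' : c ^ N • e = 0 := by
    rcases N with _ | N
    · simp only [pow_zero] at hN ⊢
      rw [one_smul, ← one_mul e, hN, zero_mul]
    · rwa [smul_pow, IsIdempotentElem.pow_succ_eq N he.idem] at hN
  rcases hx with hx | hx
  · have key : ∀ m, (c • y) ^ m * x = x := by
      intro m
      induction m with
      | zero => simp
      | succ m ih => rw [pow_succ, mul_assoc, hy', hx.1, ← hy', ih]
    rw [← key N, ← hx.2, smul_pow, smul_mul_assoc, ← mul_smul_comm, ← mul_smul_comm, hN', mul_zero,
      mul_zero]
  · have key : ∀ m, x * (c • y) ^ m = x := by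
      intro m
      induction m with
      | zero => simp
      | succ m ih => rw [pow_succ', ← mul_assoc, hy', hx.2, ← hy', ih]
    rw [← key N, ← hx.1, smul_pow, mul_smul_comm, ← smul_mul_assoc, ← smul_mul_assoc, hN', zero_mul,
      zero_mul]

end LocalIdem

end Frame

/-! ### Diagonal frames and the arithmetic of transvections. -/

section Diagonal

variable {C A P : Type*} [CommRing C] [Ring A] [Algebra C A] [Fintype P]

/-- A triangular factorization with `n = (c - 1)⁻¹` and `h = c⁻¹` in the corner of `e`: up to block
diagonal factors on either side, the element built from `c` is a lower times an upper transvection.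
The lower one does not involve `c`, and the upper one involves it only through `(c - 1)² / c`, so
two values of `c` can be compared. -/
theorem twoBlock_identity {e g p q n h : A} {c : C} (he : e * e = e)
    (heg : e * g = 0) (hge : g * e = 0) (hp : Block e g p) (hq : Block g e q)
    (hn : Block e e n) (hh : Block e e h) (hcn : (c - 1) • n = e) (hch : c • h = e) :
    (1 + (c - 1) • ((e + p * q - q) * (e + p))) * (1 - e - n + (c - 1) • (q * h * p)) =
      (1 - e - (n + e + p * q)) * ((1 + q) * (1 - (c - 1) ^ 2 • (h * (e + p * q) * p))) := by
  -- Denominators are cleared by writing `p = c (c - 1) p'` and `q = (c - 1) q'`; what remains is an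
  -- identity with polynomial coefficients in `c`.
  obtain ⟨p', hp'⟩ : ∃ p', p' = n * (h * p) := ⟨_, rfl⟩
  obtain ⟨p₁, hp₁⟩ : ∃ p₁, p₁ = h * p := ⟨_, rfl⟩
  obtain ⟨p₂, hp₂⟩ : ∃ p₂, p₂ = n * p := ⟨_, rfl⟩
  obtain ⟨q', hq'⟩ : ∃ q', q' = q * n := ⟨_, rfl⟩
  have hp₁' : p₁ = (c - 1) • p' := by
    rw [hp', ← smul_mul_assoc, hcn, ← mul_assoc, hh.1, hp₁]
  have hp₂' : p₂ = c • p' := by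
    have : h * n = n * h := by
      have h1 : c • (h * n) = n := by rw [← smul_mul_assoc, hch, hn.1]
      have h2 : c • (n * h) = n := by rw [← mul_smul_comm, hch, hn.2]
      calc h * n = h * (c • (n * h)) := by rw [h2]
        _ = c • h * (n * h) := by rw [mul_smul_comm, smul_mul_assoc]
        _ = n * h := by rw [hch, ← mul_assoc, hn.1]
    rw [hp', ← mul_assoc, ← this, mul_assoc, ← smul_mul_assoc, hch, ← mul_assoc, hn.1, hp₂]
  have hp0 : p = (c * (c - 1)) • p' := by
    rw [mul_smul, ← hp₁', hp₁, ← smul_mul_assoc, hch, hp.1]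
  have hq0 : q = (c - 1) • q' := by rw [hq', ← mul_smul_comm, hcn, hq.2]
  have bp' : Block e g p' := hp' ▸ hn.mul (hh.mul hp)
  have bq' : Block g e q' := hq' ▸ hq.mul hn
  have r1 : n * p₁ = p' := by rw [hp₁, hp']
  have r2 : h * p = p₁ := hp₁.symm
  have r3 : n * p = p₂ := hp₂.symm
  have r4 : q * n = q' := hq'.symm
  have r5 : p * e = 0 := hp.mul_right_zero hge
  have r6 : g * p = 0 := hp.mul_left_zero hge
  have r7 : q * g = 0 := hq.mul_right_zero heg
  have r8 : e * q = 0 := hq.mul_left_zero heg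
  have r9 : p * p = 0 := hp.mul_eq_zero hp hge
  have r10 : q * q = 0 := hq.mul_eq_zero hq heg
  have r11 : p * n = 0 := hp.mul_eq_zero hn hge
  have r12 : n * q = 0 := hn.mul_eq_zero hq heg
  have r13 : p * p₁ = 0 := by rw [hp₁, ← mul_assoc, hp.mul_eq_zero hh hge, zero_mul]
  have r14 : e * p₁ = p₁ := by rw [hp₁, ← mul_assoc, hh.1]
  simp only [mul_add, add_mul, mul_sub, sub_mul, mul_one, one_mul, mul_assoc, smul_mul_assoc,
    mul_smul_comm, smul_add, smul_sub, smul_smul, he, heg, hge, hp.1, hp.2, hq.1, hq.2, hn.1, hn.2,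
    hh.1, hh.2, r1, r2, r3, r4, r5, r6, r7, r8, r9, r10, r11, r12, r13, r14,
    mul_assoc_of_eq he, mul_assoc_of_eq heg, mul_assoc_of_eq hge, mul_assoc_of_eq hp.1,
    mul_assoc_of_eq hp.2, mul_assoc_of_eq hq.1, mul_assoc_of_eq hq.2, mul_assoc_of_eq hn.1,
    mul_assoc_of_eq hn.2, mul_assoc_of_eq hh.1, mul_assoc_of_eq hh.2, mul_assoc_of_eq r1,
    mul_assoc_of_eq r2, mul_assoc_of_eq r3, mul_assoc_of_eq r4, mul_assoc_of_eq r5,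
    mul_assoc_of_eq r6, mul_assoc_of_eq r7, mul_assoc_of_eq r8, mul_assoc_of_eq r9,
    mul_assoc_of_eq r10, mul_assoc_of_eq r11, mul_assoc_of_eq r12, mul_assoc_of_eq r13,
    mul_assoc_of_eq r14, zero_mul, mul_zero, smul_zero]
  clear r1 r2 r3 r4 r5 r6 r7 r8 r9 r10 r11 r12 r13 r14 hp' hq' hp₁ hp₂
  subst hp₁' hp₂'
  have hcn' := hcn.symm
  rw [hp0, hq0]
  simp only [smul_mul_assoc, mul_smul_comm, smul_smul]
  rw [hcn']
  module

/-- `S` is the set of elements of a group of units of `A` containing all units which commute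
with the complete orthogonal family `f` of local idempotents. -/
structure DiagonalFrame (C : Type*) {A P : Type*} [CommRing C] [Ring A] [Algebra C A] [Fintype P]
    (f : P → A) (S : Submonoid A) : Prop where
  orth : CompleteOrthogonalIdempotents f
  loc : ∀ p, LocalIdem C (f p)
  isUnit : ∀ a ∈ S, IsUnit a
  inv_mem : ∀ a b, a ∈ S → a * b = 1 → b ∈ S
  diag_mem : ∀ d, IsUnit d → (∀ p, f p * d = d * f p) → d ∈ S

theorem isUnit_one_add_of_mul_self {x : A} (hx : x * x = 0) : IsUnit (1 + x) :=
  ⟨⟨1 + x, 1 - x, by noncomm_ring; simp [hx], by noncomm_ring; simp [hx]⟩, rfl⟩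

theorem isUnit_one_sub_of_mul_self {x : A} (hx : x * x = 0) : IsUnit (1 - x) :=
  sub_eq_add_neg (1 : A) x ▸ isUnit_one_add_of_mul_self (by rw [neg_mul_neg, hx])

theorem isUnit_corner_unit {e : A} (he : e * e = e) (u : Aˣ) (hu : e * u = u * e) :
    IsUnit (1 - e + e * u) := by
  have hu' : e * ↑u⁻¹ = ↑u⁻¹ * e := (show Commute e (u : A) from hu).units_inv_right
  have key : ∀ u v : A, e * u = u * e → u * v = 1 → (1 - e + e * u) * (1 - e + e * v) = 1 := by
    intro u v h huv
    simp only [mul_add, add_mul, mul_sub, sub_mul, mul_one, one_mul, mul_assoc, ← h, he,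
      mul_assoc_of_eq he, mul_assoc_of_eq h.symm, huv]
    abel
  exact ⟨⟨_, _, key _ _ hu u.mul_inv, key _ _ hu' u.inv_mul⟩, rfl⟩

theorem isUnit_add_of_unitAt {e x : A} (he : e * e = e) (hx : UnitAt e x) :
    IsUnit (x + (1 - e)) := by
  obtain ⟨y, h⟩ := hx
  refine ⟨⟨x + (1 - e), y + (1 - e), ?_, ?_⟩, rfl⟩
  · simp only [mul_add, add_mul, mul_sub, sub_mul, mul_one, one_mul, h.mul, h.left.2, h.right.1, he]
    abel
  · simp only [mul_add, add_mul, mul_sub, sub_mul, mul_one, one_mul, h.mul', h.left.1, h.right.2,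
      he]
    abel

namespace DiagonalFrame

variable {f : P → A} {S : Submonoid A} (D : DiagonalFrame C f S)
include D

theorem mem_of_mul_mem_left {a b : A} (ha : a ∈ S) (h : a * b ∈ S) : b ∈ S := by
  obtain ⟨u, rfl⟩ := D.isUnit a ha
  have := S.mul_mem (D.inv_mem _ _ ha u.mul_inv) h
  rwa [u.inv_mul_cancel_left] at this

theorem mem_of_mul_mem_right {a b : A} (ha : a ∈ S) (h : b * a ∈ S) : b ∈ S := by
  obtain ⟨u, rfl⟩ := D.isUnit a ha
  have := S.mul_mem h (D.inv_mem _ _ ha u.mul_inv)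
  rwa [u.mul_inv_cancel_right] at this

theorem idem (p : P) : f p * f p = f p := (D.loc p).idem

theorem mul_ne {p q : P} (h : p ≠ q) : f p * f q = 0 := D.orth.ortho h

theorem comm_of_block {p : P} {x : A} (hx : Block (f p) (f p) x) (r : P) :
    f r * x = x * f r := by
  by_cases h : r = p
  · rw [h, hx.1, hx.2]
  · rw [hx.mul_left_zero (D.mul_ne h), hx.mul_right_zero (D.mul_ne (Ne.symm h))]

theorem unitAt_add_mem {p : P} {x : A} (hx : UnitAt (f p) x) : x + (1 - f p) ∈ S := by
  refine D.diag_mem _ (isUnit_add_of_unitAt (D.idem p) hx) fun r => ?_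
  obtain ⟨y, h⟩ := hx
  have h1 := D.comm_of_block h.left r
  have h2 := D.comm_of_block (Block.self (D.idem p)) r
  rw [mul_add, add_mul, h1, mul_sub, sub_mul, h2, mul_one, one_mul]

variable {p q r : P} {x y a : A}

theorem add_mem (hpq : p ≠ q) (hx : Block (f p) (f q) x) (hy : Block (f p) (f q) y)
    (hxS : 1 + x ∈ S) (hyS : 1 + y ∈ S) : 1 + (x + y) ∈ S := by
  have h : (1 + x) * (1 + y) = 1 + (x + y) := by
    rw [mul_add, add_mul, add_mul, hx.mul_eq_zero hy (D.mul_ne hpq.symm)]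
    simp only [mul_one, one_mul]
    abel
  exact h ▸ S.mul_mem hxS hyS

theorem neg_mem (hpq : p ≠ q) (hx : Block (f p) (f q) x) (hxS : 1 + x ∈ S) : 1 + -x ∈ S := by
  refine D.inv_mem _ _ hxS ?_
  have := hx.mul_eq_zero hx (D.mul_ne hpq.symm)
  simp only [mul_add, add_mul, mul_one, one_mul, mul_neg, this]
  abel

theorem sub_mem (hpq : p ≠ q) (hx : Block (f p) (f q) x) (hy : Block (f p) (f q) y)
    (hxS : 1 + x ∈ S) (hyS : 1 + y ∈ S) : 1 + (x - y) ∈ S :=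
  sub_eq_add_neg x y ▸ D.add_mem hpq hx hy.neg hxS (D.neg_mem hpq hy hyS)

/-- Conjugation by the diagonal unit that equals `a` on the corner of `f p` and `1` elsewhere. -/
theorem unit_mul_mem (hpq : p ≠ q) (hx : Block (f p) (f q) x) (hxS : 1 + x ∈ S)
    (ha : UnitAt (f p) a) : 1 + a * x ∈ S := by
  have hd := D.unitAt_add_mem ha
  refine D.mem_of_mul_mem_right hd ?_
  have h : (1 + a * x) * (a + (1 - f p)) = (a + (1 - f p)) * (1 + x) := by
    obtain ⟨b, hb⟩ := ha
    simp only [mul_add, add_mul, mul_sub, sub_mul, mul_one, one_mul, mul_assoc, hx.1,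
      hx.mul_eq_zero hb.left (D.mul_ne hpq.symm), hx.mul_right_zero (D.mul_ne hpq.symm), mul_zero]
    abel
  exact h ▸ S.mul_mem hd hxS

theorem mul_unit_mem (hpq : p ≠ q) (hx : Block (f p) (f q) x) (hxS : 1 + x ∈ S)
    (ha : UnitAt (f q) a) : 1 + x * a ∈ S := by
  have hd := D.unitAt_add_mem ha
  refine D.mem_of_mul_mem_left hd ?_
  have h : (a + (1 - f q)) * (1 + x * a) = (1 + x) * (a + (1 - f q)) := by
    obtain ⟨b, hb⟩ := ha
    simp only [mul_add, add_mul, mul_sub, sub_mul, mul_one, one_mul, ← mul_assoc, hx.2,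
      hb.left.mul_eq_zero hx (D.mul_ne hpq.symm), hx.mul_left_zero (D.mul_ne hpq.symm), zero_mul]
    abel
  exact h ▸ S.mul_mem hxS hd

/-- A nilpotent `a` is the difference of the units `f p` and `f p - a`, which reduces it to the unit
case. -/
theorem left_mul_mem (hpq : p ≠ q) (hx : Block (f p) (f q) x) (hxS : 1 + x ∈ S)
    (ha : Block (f p) (f p) a) : 1 + a * x ∈ S := by
  rcases (D.loc p).dichotomy a ha with hn | hu
  · have h := D.unit_mul_mem hpq hx hxS ((D.loc p).unitAt_sub_of_isNilpotent ha hn)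
    have hb := ((Block.self (D.idem p)).sub ha).mul hx
    have := D.sub_mem hpq hx hb hxS h
    rwa [sub_mul, hx.1, sub_sub_cancel] at this
  · exact D.unit_mul_mem hpq hx hxS hu

theorem right_mul_mem (hpq : p ≠ q) (hx : Block (f p) (f q) x) (hxS : 1 + x ∈ S)
    (ha : Block (f q) (f q) a) : 1 + x * a ∈ S := by
  rcases (D.loc q).dichotomy a ha with hn | hu
  · have h := D.mul_unit_mem hpq hx hxS ((D.loc q).unitAt_sub_of_isNilpotent ha hn)
    have hb := hx.mul ((Block.self (D.idem q)).sub ha)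
    have := D.sub_mem hpq hx hb hxS h
    rwa [mul_sub, hx.2, sub_sub_cancel] at this
  · exact D.mul_unit_mem hpq hx hxS hu

/-- The commutator of `1 + x` and `1 + y` is `1 + x * y`. -/
theorem mul_mem (hqr : q ≠ r) (hpr : p ≠ r) (hx : Block (f p) (f q) x)
    (hy : Block (f q) (f r) y) (hxS : 1 + x ∈ S) (hyS : 1 + y ∈ S) : 1 + x * y ∈ S := by
  have h : (1 + x) * (1 + y) = (1 + x * y) * ((1 + y) * (1 + x)) := by
    simp only [mul_add, add_mul, mul_one, one_mul, mul_assoc, hy.mul_eq_zero hx (D.mul_ne hpr.symm),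
      hy.mul_eq_zero hy (D.mul_ne hqr.symm),
      mul_assoc_of_eq (hy.mul_eq_zero hy (D.mul_ne hqr.symm)), mul_zero, zero_mul]
    abel
  exact D.mem_of_mul_mem_right (S.mul_mem hyS hxS) (h ▸ S.mul_mem hxS hyS)

theorem isUnit_sum {x : P → A} (hx : ∀ p, UnitAt (f p) (x p)) : IsUnit (∑ p, x p) := by
  classical
  choose y hy using hx
  have key : ∀ x y : P → A, (∀ p, InvAt (f p) (x p) (y p)) → (∑ p, x p) * ∑ p, y p = 1 := by
    intro x y h
    rw [Finset.sum_mul_sum, ← D.orth.complete]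
    refine Finset.sum_congr rfl fun p _ => ?_
    rw [Finset.sum_eq_single p, (h p).mul]
    · exact fun q _ hqp => (h p).left.mul_eq_zero (h q).right (D.mul_ne hqp.symm)
    · simp
  exact ⟨⟨_, _, key x y hy, key y x fun p => (hy p).symm⟩, rfl⟩

/-- There is a diagonal unit `u` such that `u - 1` is a unit. -/
theorem exists_unit_sub_one : ∃ u v : Aˣ, (v : A) = u - 1 ∧ ∀ p, f p * u = u * f p := by
  have h : ∀ p, ∃ c : C, UnitAt (f p) (c • f p) ∧ UnitAt (f p) ((c - 1) • f p) := by
    intro p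
    have he := Block.self (D.idem p)
    obtain ⟨c, hc⟩ := (D.loc p).exists_smul_add_unitAt (k := 2) (by omega)
      ![f p, f p] ![0, -f p] (by simp [Fin.forall_fin_two, he])
      (by simp [Fin.forall_fin_two, he.neg, Block.zero]) (by simp [Fin.forall_fin_two])
      (by simp [Fin.forall_fin_two, (D.loc p).not_isNilpotent])
    refine ⟨c, by simpa using hc 0, ?_⟩
    rw [sub_smul, one_smul, sub_eq_add_neg]
    exact hc 1
  choose c hc using h
  obtain ⟨u, hu⟩ := D.isUnit_sum fun p => (hc p).1
  obtain ⟨v, hv⟩ := D.isUnit_sum fun p => (hc p).2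
  refine ⟨u, v, ?_, fun p => ?_⟩
  · rw [hu, hv, ← D.orth.complete, ← Finset.sum_sub_distrib]
    simp only [sub_smul, one_smul]
  · rw [hu, Finset.mul_sum, Finset.sum_mul]
    refine Finset.sum_congr rfl fun q _ => ?_
    exact D.comm_of_block ((Block.self (D.idem q)).smul _) p

end DiagonalFrame

end Diagonal

/-! ### Extraction of transvections with two blocks. -/

section Extraction

variable {C A P : Type*} [CommRing C] [Ring A] [Algebra C A] [Fintype P]

namespace DiagonalFrame

variable {f : P → A} {S : Submonoid A} (D : DiagonalFrame C f S)
include D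

/-- An element of the group which fixes the block of `e` may be replaced by its complementary
diagonal block. -/
theorem add_one_sub_mul_mem {e w : A} (he : e * e = e)
    (hfe : ∀ x, (∀ p, f p * x = x * f p) → x * e = e * x) (hw : w ∈ S) (hwe : w * e = e) : e + (1 - e) * w ∈ S := by
  obtain ⟨u, v, hvu, huf⟩ := D.exists_unit_sub_one
  obtain ⟨w', hw'⟩ := D.isUnit w hw
  obtain ⟨x, hx⟩ : ∃ x, x = (↑w'⁻¹ : A) := ⟨_, rfl⟩
  have hxw : x * w = 1 := by rw [hx, ← hw', w'.inv_mul]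
  have hwx : w * x = 1 := by rw [hx, ← hw', w'.mul_inv]
  have hxe : x * e = e := by rw [← hwe, ← mul_assoc, hxw, one_mul, hwe]
  have hef : ∀ p, f p * e = e * f p := fun p => hfe _ (D.comm_of_block (Block.self (D.idem p)))
  have hue := hfe u huf
  have hve : (v : A) * e = e * v := by
    rw [hvu, sub_mul, mul_sub, hue, one_mul, mul_one]
  have hvf : ∀ p, f p * v = v * f p := by
    intro p
    rw [hvu, mul_sub, sub_mul, huf, one_mul, mul_one]
  have hmem : ∀ z : Aˣ, (z : A) * e = e * z → (∀ p, f p * z = z * f p) → 1 - e + e * z ∈ S := by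
    intro z hze hzf
    refine D.diag_mem _ (isUnit_corner_unit he z hze.symm) fun p => ?_
    rw [mul_add, add_mul, mul_sub, sub_mul, hef, mul_one, one_mul, ← mul_assoc, hef, mul_assoc,
      mul_assoc, hzf]
  have hd := hmem u hue huf
  have hd' := hmem v hve hvf
  -- With `x = w⁻¹` this gives `w = (1 + k) * (e + (1 - e) * w)`, so it suffices to put `1 + k` into
  -- the group.
  obtain ⟨k, hk⟩ : ∃ k, k = e - e * x := ⟨_, rfl⟩
  have hek : e * k = k := by rw [hk, mul_sub, ← mul_assoc, he]
  have hke : k * e = 0 := by rw [hk, sub_mul, mul_assoc, hxe, he, sub_self]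
  have hkw : k * w = e * w - e := by rw [hk, sub_mul, mul_assoc, hxw, mul_one]
  -- This is the commutator of `w` with the diagonal unit acting as `u` on `e`. As `v = u - 1` is
  -- itself a unit, a further diagonal conjugation removes it.
  have h1 : 1 + v * k ∈ S := by
    refine D.mem_of_mul_mem_right (S.mul_mem hw hd) ?_
    have : (1 + v * k) * (w * (1 - e + e * u)) = (1 - e + e * u) * w := by
      simp only [hvu, mul_add, add_mul, mul_sub, sub_mul, mul_one, one_mul, mul_assoc, hue, hwe,
        he, hkw, mul_assoc_of_eq he, mul_assoc_of_eq hwe, mul_assoc_of_eq hkw, mul_assoc_of_eq hue,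
        hke, mul_assoc_of_eq hke, zero_mul, mul_zero]
      abel
    exact this ▸ S.mul_mem hd hw
  have h2 : 1 + k ∈ S := by
    refine D.mem_of_mul_mem_left hd' ?_
    have : (1 - e + e * v) * (1 + k) = (1 + v * k) * (1 - e + e * v) := by
      simp only [mul_add, add_mul, mul_sub, sub_mul, mul_one, one_mul, mul_assoc, hek, hke,
        mul_assoc_of_eq hke, zero_mul, mul_zero]
      rw [← mul_assoc e, ← hve, mul_assoc, hek]
      abel
    exact this ▸ S.mul_mem h1 hd'
  refine D.mem_of_mul_mem_left h2 ?_
  have : (1 + k) * (e + (1 - e) * w) = w := by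
    simp only [mul_add, add_mul, mul_sub, sub_mul, mul_one, one_mul, mul_assoc, he, hek, hke, hkw,
      mul_assoc_of_eq hke, zero_mul, mul_zero]
    abel
  rwa [this]

variable {j k : P}

/-- Extraction of a transvection in the case of two blocks. -/
theorem one_add_mem_of_two_blocks {p q : A} (hjk : j ≠ k) (hp : Block (f j) (f k) p)
    (hq : Block (f k) (f j) q)
    (h : ∀ c : C, UnitAt (f j) (c • f j) →
      1 + (c - 1) • ((f j + p * q - q) * (f j + p)) ∈ S) : 1 + q ∈ S := by
  have he := D.idem j
  have heb := Block.self he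
  have hjkz := D.mul_ne hjk
  have hkjz := D.mul_ne hjk.symm
  have hqq := hq.mul_eq_zero hq hjkz
  have hm := hp.mul hq
  have hN := heb.add hm
  have hNm : Commute (f j + p * q) (p * q) := by
    refine Commute.add_left ?_ (Commute.refl _)
    rw [Commute, SemiconjBy, hm.1, hm.2]
  -- These commuting elements add up to `f j`, which is not nilpotent.
  have hcop : IsNilpotent (f j + p * q) → ¬ IsNilpotent (-(p * q)) := by
    intro h1 h2
    have := (hNm.neg_right).isNilpotent_add h1 h2
    rw [add_neg_cancel_right] at this
    exact (D.loc j).not_isNilpotent this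
  -- the element extracted from one scalar
  have key : ∀ (c : C) (n h' : A), InvAt (f j) ((c - 1) • f j) n → InvAt (f j) (c • f j) h' →
      UnitAt (f j) (c • (f j + p * q) + -(p * q)) →
      (1 + q) * (1 - (c - 1) ^ 2 • (h' * (f j + p * q) * p)) ∈ S := by
    intro c n h' hn hh ha
    have hcn : (c - 1) • n = f j := by rw [← hn.mul', mul_smul_comm, hn.right.2]
    have hch : c • h' = f j := by rw [← hh.mul', mul_smul_comm, hh.right.2]
    have hid := twoBlock_identity he hjkz hkjz hp hq hn.right hh.right hcn hch
    have hX := h c ⟨_, hh⟩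
    have hna : UnitAt (f j) (-(n + f j + p * q)) := by
      have h1 : n * (c • (f j + p * q) + -(p * q)) = n + f j + p * q := by
        have h2 : c • (f j + p * q) + -(p * q) = f j + (c - 1) • (f j + p * q) := by module
        rw [h2, mul_add, hn.right.2, mul_smul_comm, ← smul_mul_assoc, hcn, hN.1, add_assoc]
      exact (h1 ▸ UnitAt.mul ⟨_, hn.symm⟩ ha).neg
    have hd1 : 1 - f j - (n + f j + p * q) ∈ S := by
      have := D.unitAt_add_mem hna
      rwa [neg_add_eq_sub] at this
    have hz : (h' * (f j + p * q) * p) * (h' * (f j + p * q) * p) = 0 :=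
      ((hh.right.mul hN).mul hp).mul_eq_zero ((hh.right.mul hN).mul hp) hkjz
    have hu2 : IsUnit (1 - f j - n + (c - 1) • (q * h' * p)) := by
      have hr : IsUnit ((1 - f j - (n + f j + p * q)) * ((1 + q) *
          (1 - (c - 1) ^ 2 • (h' * (f j + p * q) * p)))) := by
        refine (D.isUnit _ hd1).mul ((isUnit_one_add_of_mul_self hqq).mul
          (isUnit_one_sub_of_mul_self ?_))
        rw [smul_mul_assoc, mul_smul_comm, hz, smul_zero, smul_zero]
      rw [← hid] at hr
      obtain ⟨x, hx⟩ := D.isUnit _ hX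
      rw [← hx] at hr
      exact (Units.isUnit_units_mul x _).1 hr
    have hd2 : 1 - f j - n + (c - 1) • (q * h' * p) ∈ S := by
      refine D.diag_mem _ hu2 fun r => ?_
      have h1 := D.comm_of_block heb r
      have h2 := D.comm_of_block hn.right r
      have h3 := D.comm_of_block (((hq.mul hh.right).mul hp).smul (c - 1)) r
      rw [mul_add, add_mul, mul_sub, sub_mul, mul_sub, sub_mul, h1, h2, h3, mul_one, one_mul]
    exact D.mem_of_mul_mem_left hd1 (hid ▸ S.mul_mem hX hd2)
  have hnil := (D.loc j).not_isNilpotent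
  -- The conditions make `c`, `c - 1` and `c (f j + p q) - p q` invertible, as `key` requires.
  obtain ⟨c, hc⟩ := (D.loc j).exists_smul_add_unitAt (k := 3) (by omega)
    ![f j, f j, f j + p * q] ![0, -f j, -(p * q)]
    (by simp [Fin.forall_fin_succ, heb, hN]) (by simp [Fin.forall_fin_succ, heb.neg, hm.neg, Block.zero])
    (by simpa [Fin.forall_fin_succ] using hNm) (by simpa [Fin.forall_fin_succ, hnil] using hcop)
  have hc0 : UnitAt (f j) (c • f j) := by simpa using hc 0
  have hc1 : UnitAt (f j) ((c - 1) • f j) := by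
    rw [sub_smul, one_smul, sub_eq_add_neg]
    exact hc 1
  have hc2 : UnitAt (f j) (c • (f j + p * q) + -(p * q)) := hc 2
  have hcnil := hc0.not_isNilpotent hnil
  -- Besides the same three conditions, `d - c` and `d c - 1` must be invertible: they are the
  -- factors of the numerator of `(d - 1)² / d - (c - 1)² / c = (d c - 1)(d - c) / (d c)`.
  obtain ⟨d, hd⟩ := (D.loc j).exists_smul_add_unitAt (k := 5) (by omega)
    ![f j, f j, f j + p * q, f j, c • f j] ![0, -f j, -(p * q), -(c • f j), -f j]
    (by simp [Fin.forall_fin_succ, heb, hN, heb.smul])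
    (by simp [Fin.forall_fin_succ, heb.neg, hm.neg, Block.zero, (heb.smul c).neg])
    (by simpa [Fin.forall_fin_succ, Commute.smul_left, Commute.smul_right] using hNm)
    (by simpa [Fin.forall_fin_succ, hnil, hcnil] using hcop)
  have hd0 : UnitAt (f j) (d • f j) := by simpa using hd 0
  have hd1 : UnitAt (f j) ((d - 1) • f j) := by
    rw [sub_smul, one_smul, sub_eq_add_neg]
    exact hd 1
  have hd2 : UnitAt (f j) (d • (f j + p * q) + -(p * q)) := hd 2
  have hd3 : UnitAt (f j) ((d - c) • f j) := by
    rw [sub_smul, sub_eq_add_neg]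
    exact hd 3
  have hd4 : UnitAt (f j) ((d * c - 1) • f j) := by
    rw [sub_smul, one_smul, sub_eq_add_neg, mul_smul]
    exact hd 4
  obtain ⟨n₁, hn₁⟩ := hc1
  obtain ⟨h₁, hh₁⟩ := hc0
  obtain ⟨n₂, hn₂⟩ := hd1
  obtain ⟨h₂, hh₂⟩ := hd0
  have k1 := key c n₁ h₁ hn₁ hh₁ hc2
  have k2 := key d n₂ h₂ hn₂ hh₂ hd2
  have hch : c • h₁ = f j := by rw [← hh₁.mul', mul_smul_comm, hh₁.right.2]
  have hdh : d • h₂ = f j := by rw [← hh₂.mul', mul_smul_comm, hh₂.right.2]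
  obtain ⟨t, ht⟩ : ∃ t, t = (f j + p * q) * p := ⟨_, rfl⟩
  have htb : Block (f j) (f k) t := ht ▸ hN.mul hp
  rw [mul_assoc, ← ht] at k1 k2
  have hb1 : Block (f j) (f j) ((c - 1) ^ 2 • h₁) := hh₁.right.smul _
  have hb2 : Block (f j) (f j) ((d - 1) ^ 2 • h₂) := hh₂.right.smul _
  rw [← smul_mul_assoc] at k1 k2
  have hdiff : UnitAt (f j) ((d - 1) ^ 2 • h₂ - (c - 1) ^ 2 • h₁) := by
    have h1 : (d - 1) ^ 2 • h₂ - (c - 1) ^ 2 • h₁ =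
        (h₁ * h₂) * (((d * c - 1) • f j) * ((d - c) • f j)) := by
      have e1 : h₁ * h₂ * f j = h₁ * h₂ := by rw [mul_assoc, hh₂.right.2]
      have e2 : h₂ = c • (h₁ * h₂) := by rw [← smul_mul_assoc, hch, hh₂.right.1]
      have e3 : h₁ = d • (h₁ * h₂) := by rw [← mul_smul_comm, hdh, hh₁.right.2]
      simp only [smul_mul_assoc, mul_smul_comm, he, e1]
      generalize h₁ * h₂ = z at e2 e3
      rw [e2, e3]
      module
    rw [h1]
    exact (UnitAt.mul ⟨_, hh₁.symm⟩ ⟨_, hh₂.symm⟩).mul (hd4.mul hd3)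
  -- In the quotient of the elements obtained from `c` and `d` the factor `1 + q` cancels, leaving a
  -- unit multiple of `t`.
  have htS : 1 + t ∈ S := by
    have h1 : 1 + ((d - 1) ^ 2 • h₂ - (c - 1) ^ 2 • h₁) * t ∈ S := by
      have h2 : (1 + q) * (1 - (d - 1) ^ 2 • h₂ * t) *
          (1 + ((d - 1) ^ 2 • h₂ - (c - 1) ^ 2 • h₁) * t) =
          (1 + q) * (1 - (c - 1) ^ 2 • h₁ * t) := by
        rw [mul_assoc]
        congr 1
        have z1 := (hb2.mul htb).mul_eq_zero (hb2.mul htb) hkjz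
        have z2 := (hb2.mul htb).mul_eq_zero (hb1.mul htb) hkjz
        simp only [mul_add, add_mul, mul_sub, sub_mul, mul_one, one_mul, z1, z2]
        abel
      exact D.mem_of_mul_mem_left k2 (h2 ▸ k1)
    obtain ⟨z, hz⟩ := hdiff
    have h2 := D.unit_mul_mem hjk (hz.left.mul htb) h1 ⟨_, hz.symm⟩
    rwa [← mul_assoc, hz.mul', htb.1] at h2
  have hS := D.neg_mem hjk (hb1.mul htb) (D.left_mul_mem hjk htb htS hb1)
  rw [← sub_eq_add_neg] at hS
  exact D.mem_of_mul_mem_right hS k1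

end DiagonalFrame

end Extraction

/-! ### Elements differing from one in a single row and column; conjugates of corners. -/

section Normality

variable {C A P : Type*} [CommRing C] [Ring A] [Algebra C A] [Fintype P]

namespace DiagonalFrame

variable {f : P → A} {S : Submonoid A} (D : DiagonalFrame C f S)
include D

theorem smul_unit_mem {j : P} {c : C} (hc : UnitAt (f j) (c • f j)) :
    1 + (c - 1) • f j ∈ S := by
  have := D.unitAt_add_mem hc
  rwa [show c • f j + (1 - f j) = 1 + (c - 1) • f j by module] at this

/-- The conjugate of `1 + (c - 1) f j` by `((1 + q)(1 + p))⁻¹` acts as `1` on the right factor `1 -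
f j - f k`. Discarding its rows outside `j` and `k` by `add_one_sub_mul_mem` leaves exactly the
element treated in the case of two blocks. -/
theorem one_add_row_mem {j k : P} {p q : A} (hjk : j ≠ k) (hp : Block (1 - f k) (f k) p)
    (hq : Block (f k) (1 - f k) q) (hy : (1 + q) * (1 + p) ∈ S) : 1 + q * f j ∈ S := by
  have he := D.idem j
  have hg := D.idem k
  have heg := D.mul_ne hjk
  have hge := D.mul_ne hjk.symm
  have hgp : f k * p = 0 := hp.mul_left_zero (by rw [mul_sub, hg, mul_one, sub_self])
  have hqg : q * f k = 0 := hq.mul_right_zero (by rw [sub_mul, hg, one_mul, sub_self])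
  have hpp : p * p = 0 := by rw [← hp.2, mul_assoc, mul_assoc_of_eq hgp, zero_mul, mul_zero]
  have hqq : q * q = 0 := by rw [← hq.1, mul_assoc, mul_assoc_of_eq hqg, zero_mul, mul_zero]
  have heq : f j * q = 0 := hq.mul_left_zero heg
  have hpe : p * f j = 0 := hp.mul_right_zero hge
  have hpb : Block (f j) (f k) (f j * p) := ⟨by rw [← mul_assoc, he], by rw [mul_assoc, hp.2]⟩
  have hqb : Block (f k) (f j) (q * f j) := ⟨by rw [← mul_assoc, hq.1], by rw [mul_assoc, he]⟩
  refine D.one_add_mem_of_two_blocks hjk hpb hqb fun c hc => ?_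
  have hinv : (1 - p) * (1 - q) ∈ S := by
    refine D.inv_mem _ _ hy ?_
    simp only [mul_add, add_mul, mul_sub, sub_mul, mul_one, one_mul, mul_assoc, hpp, hqq,
      mul_assoc_of_eq hpp, mul_zero, zero_mul]
    abel
  have hw := S.mul_mem hinv (S.mul_mem (D.smul_unit_mem hc) hy)
  have h1 := D.add_one_sub_mul_mem (e := 1 - f j - f k) ?_ ?_ hw ?_
  · convert h1 using 1
    simp only [mul_add, add_mul, mul_sub, sub_mul, mul_one, one_mul, mul_assoc, smul_mul_assoc,
      mul_smul_comm, smul_add, smul_sub, smul_smul, he, hg, heg, hge, hgp, hqg, hpp, hqq, heq, hpe,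
      hp.2, hq.1, mul_assoc_of_eq he, mul_assoc_of_eq hg, mul_assoc_of_eq heg, mul_assoc_of_eq hge,
      mul_assoc_of_eq hgp, mul_assoc_of_eq hqg, mul_assoc_of_eq hpp, mul_assoc_of_eq hqq,
      mul_assoc_of_eq heq, mul_assoc_of_eq hpe, mul_assoc_of_eq hp.2, mul_assoc_of_eq hq.1,
      mul_zero, zero_mul, smul_zero]
    module
  · simp only [mul_sub, sub_mul, mul_one, one_mul, he, hg, heg, hge]
    abel
  · intro x hx
    simp only [mul_sub, sub_mul, mul_one, one_mul, hx]
  · simp only [mul_add, add_mul, mul_sub, sub_mul, mul_one, one_mul, mul_assoc, smul_mul_assoc,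
      mul_smul_comm, smul_add, smul_sub, smul_smul, he, hg, heg, hge, hgp, hqg, hpp, hqq, heq, hpe,
      hp.2, hq.1, mul_assoc_of_eq he, mul_assoc_of_eq hg, mul_assoc_of_eq heg, mul_assoc_of_eq hge,
      mul_assoc_of_eq hgp, mul_assoc_of_eq hqg, mul_assoc_of_eq hpp, mul_assoc_of_eq hqq,
      mul_assoc_of_eq heq, mul_assoc_of_eq hpe, mul_assoc_of_eq hp.2, mul_assoc_of_eq hq.1,
      mul_zero, zero_mul, smul_zero]
    module

/-- The commutator with the diagonal unit `1 + (c - 1) f j` isolates `(c - 1) f j * p`, and `c` is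
chosen so that `c - 1` can be divided out. -/
theorem one_add_col_mem {j k : P} {p : A} (hjk : j ≠ k) (hp : Block (1 - f k) (f k) p)
    (hpS : 1 + p ∈ S) : 1 + f j * p ∈ S := by
  have he := D.idem j
  have hge := D.mul_ne hjk.symm
  have hgp : f k * p = 0 := hp.mul_left_zero (by rw [mul_sub, D.idem, mul_one, sub_self])
  have hpp : p * p = 0 := by rw [← hp.2, mul_assoc, mul_assoc_of_eq hgp, zero_mul, mul_zero]
  have hpe : p * f j = 0 := hp.mul_right_zero hge
  have hpb : Block (f j) (f k) (f j * p) := ⟨by rw [← mul_assoc, he], by rw [mul_assoc, hp.2]⟩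
  have heb := Block.self he
  obtain ⟨c, hc⟩ := (D.loc j).exists_smul_add_unitAt (k := 2) (by omega)
      ![f j, f j] ![0, -f j] (by simp [Fin.forall_fin_two, heb])
      (by simp [Fin.forall_fin_two, heb.neg, Block.zero]) (by simp [Fin.forall_fin_two])
      (by simp [Fin.forall_fin_two, (D.loc j).not_isNilpotent])
  have hc0 : UnitAt (f j) (c • f j) := by simpa using hc 0
  have hc1 : UnitAt (f j) ((c - 1) • f j) := by
    rw [sub_smul, one_smul, sub_eq_add_neg]
    exact hc 1
  have hd := D.smul_unit_mem hc0
  have h1 : 1 + (c - 1) • f j * p ∈ S := by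
    refine D.mem_of_mul_mem_right (S.mul_mem hpS hd) ?_
    have : (1 + (c - 1) • f j * p) * ((1 + p) * (1 + (c - 1) • f j)) =
        (1 + (c - 1) • f j) * (1 + p) := by
      simp only [mul_add, add_mul, mul_one, one_mul, mul_assoc, smul_mul_assoc, mul_smul_comm, hpp,
        hpe, smul_zero, mul_zero]
      module
    exact this ▸ S.mul_mem hd hpS
  obtain ⟨z, hz⟩ := hc1
  have hb : Block (f j) (f k) ((c - 1) • f j * p) := by
    rw [smul_mul_assoc]
    exact hpb.smul _
  have h2 := D.unit_mul_mem hjk hb h1 ⟨_, hz.symm⟩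
  rwa [← mul_assoc, hz.mul'] at h2

theorem one_add_row_mem_of_forall {k : P} {q : A} (hq : Block (f k) (1 - f k) q)
    (h : ∀ j, j ≠ k → 1 + q * f j ∈ S) : 1 + q ∈ S := by
  classical
  have hqg : q * f k = 0 := hq.mul_right_zero (by rw [sub_mul, D.idem, one_mul, sub_self])
  have key : ∀ s : Finset P, 1 + q * ∑ j ∈ s, f j ∈ S := by
    intro s
    induction s using Finset.induction_on with
    | empty => simp
    | insert a s ha ih =>
      rw [Finset.sum_insert ha]
      by_cases hak : a = k
      · rwa [hak, mul_add, hqg, zero_add]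
      · have h1 : q * f a * q = 0 := by
          rw [mul_assoc, hq.mul_left_zero (D.mul_ne hak), mul_zero]
        have h2 : (1 + q * f a) * (1 + q * ∑ j ∈ s, f j) = 1 + q * (f a + ∑ j ∈ s, f j) := by
          rw [add_mul, mul_add, mul_add, ← mul_assoc (q * f a), h1]
          noncomm_ring
        exact h2 ▸ S.mul_mem (h a hak) ih
  have := key Finset.univ
  rwa [D.orth.complete, mul_one] at this

theorem one_add_col_mem_of_forall {k : P} {p : A} (hp : Block (1 - f k) (f k) p)
    (h : ∀ j, j ≠ k → 1 + f j * p ∈ S) : 1 + p ∈ S := by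
  classical
  have hgp : f k * p = 0 := hp.mul_left_zero (by rw [mul_sub, D.idem, mul_one, sub_self])
  have key : ∀ s : Finset P, 1 + (∑ j ∈ s, f j) * p ∈ S := by
    intro s
    induction s using Finset.induction_on with
    | empty => simp
    | insert a s ha ih =>
      rw [Finset.sum_insert ha]
      by_cases hak : a = k
      · rwa [hak, add_mul, hgp, zero_add]
      · have h1 : p * (f a * p) = 0 := by
          rw [← mul_assoc, hp.mul_right_zero (D.mul_ne (Ne.symm hak)), zero_mul]
        have h2 : (1 + (∑ j ∈ s, f j) * p) * (1 + f a * p) = 1 + (f a + ∑ j ∈ s, f j) * p := by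
          have h3 : (∑ j ∈ s, f j) * p * (f a * p) = 0 := by rw [mul_assoc, h1, mul_zero]
          rw [add_mul, mul_add, mul_add, h3]
          noncomm_ring
        exact h2 ▸ S.mul_mem ih (h a hak)
  have := key Finset.univ
  rwa [D.orth.complete, one_mul] at this

/-- If an element of the group differs from `1` only in the `k`-th row and the `k`-th column,
then its entries define transvections in the group. -/
theorem one_add_entry_mem {j k : P} {x : A} (hjk : j ≠ k) (hx : x ∈ S)
    (hxe : (1 - f k) * x * (1 - f k) = 1 - f k) : 1 + f j * x * f k ∈ S := by
  have hg := D.idem k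
  obtain ⟨e, he_def⟩ : ∃ e, e = 1 - f k := ⟨_, rfl⟩
  rw [← he_def] at hxe
  have hee : e * e = e := by simp only [he_def, mul_sub, sub_mul, mul_one, one_mul, hg]; abel
  have heg : e * f k = 0 := by rw [he_def, sub_mul, hg, one_mul, sub_self]
  have hge : f k * e = 0 := by rw [he_def, mul_sub, hg, mul_one, sub_self]
  have hej : e * f j = f j := by rw [he_def, sub_mul, D.mul_ne hjk.symm, one_mul, sub_zero]
  have hje : f j * e = f j := by rw [he_def, mul_sub, D.mul_ne hjk, mul_one, sub_zero]
  have hp := Block.mk' hee hg x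
  have hq := Block.mk' hg hee x
  have hs := Block.mk' hg hg x
  have hjp : f j * (e * x * f k) = f j * x * f k := by rw [← mul_assoc, ← mul_assoc, hje]
  have hxsum : x = e + e * x * f k + f k * x * e + f k * x * f k := by
    have h1 : e + f k = 1 := by rw [he_def, sub_add_cancel]
    calc x = (e + f k) * x * (e + f k) := by rw [h1, one_mul, mul_one]
      _ = e * x * e + e * x * f k + f k * x * e + f k * x * f k := by noncomm_ring
      _ = _ := by rw [hxe]
  rw [← hjp]
  generalize e * x * f k = p at *
  generalize f k * x * e = q at *
  generalize f k * x * f k = s at *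
  have hδ := hs.sub (hq.mul hp)
  -- The Schur complement: `x = (1 + q) * (e + δ) * (1 + p)`, with a middle factor that is a
  -- diagonal unit and hence belongs to the group.
  obtain ⟨δ, hδdef⟩ : ∃ δ, δ = s - q * p := ⟨_, rfl⟩
  rw [← hδdef] at hδ
  have hpp : p * p = 0 := hp.mul_eq_zero hp hge
  have hqq : q * q = 0 := hq.mul_eq_zero hq heg
  have hpδz : δ * p = 0 := hδ.mul_eq_zero hp hge
  have hqδ : q * δ = 0 := hq.mul_eq_zero hδ heg
  have hfac : (1 + q) * (e + δ) * (1 + p) = x := by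
    have h1 : (1 + q) * (e + δ) = e + δ + q := by
      rw [add_mul, one_mul, mul_add, hq.2, hqδ, add_zero]
    rw [h1, hxsum, mul_add, mul_one, add_mul, add_mul, hp.1, hpδz, hδdef]
    abel
  have hu : IsUnit (e + δ) := by
    obtain ⟨a, ha⟩ := isUnit_one_add_of_mul_self hqq
    obtain ⟨b, hb⟩ := isUnit_one_add_of_mul_self hpp
    have h := D.isUnit x hx
    rw [← hfac, ← ha, ← hb] at h
    exact (Units.isUnit_units_mul a _).1 ((Units.isUnit_mul_units _ b).1 h)
  have hd : e + δ ∈ S := by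
    refine D.diag_mem _ hu fun r => ?_
    rw [mul_add, add_mul, D.comm_of_block hδ, he_def, mul_sub, sub_mul,
      D.comm_of_block (Block.self hg), mul_one, one_mul]
  obtain ⟨u, hu⟩ := hu
  have hdp : (u : A) * p = p := by rw [hu, add_mul, hp.1, hpδz, add_zero]
  have hpd : Block e (f k) (p * ↑u⁻¹) := by
    refine ⟨by rw [← mul_assoc, hp.1], ?_⟩
    have hcomm : Commute (u : A) (f k) := by
      rw [hu, Commute, SemiconjBy, add_mul, mul_add, heg, hge, hδ.1, hδ.2]
    rw [mul_assoc, (hcomm.units_inv_left).eq, ← mul_assoc, hp.2]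
  -- Moving the diagonal factor to the right end and removing it replaces `p` by `p * u⁻¹` and
  -- leaves a pure product of row and column.
  have hy : (1 + q) * (1 + p * ↑u⁻¹) ∈ S := by
    have h1 : (1 + q) * (1 + p * ↑u⁻¹) * (e + δ) = x := by
      have h2 : (1 + p * ↑u⁻¹) * u = u * (1 + p) := by
        rw [add_mul, one_mul, mul_assoc, u.inv_mul, mul_one, mul_add, mul_one, hdp]
      rw [← hfac, mul_assoc, mul_assoc, ← hu, h2]
    exact D.mem_of_mul_mem_right hd (h1 ▸ hx)
  rw [he_def] at hq hpd
  have hqS : 1 + q ∈ S :=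
    D.one_add_row_mem_of_forall hq fun i hi => D.one_add_row_mem hi hpd hq hy
  have hpS := D.one_add_col_mem hjk hpd (D.mem_of_mul_mem_left hqS hy)
  refine D.mem_of_mul_mem_left hd ?_
  have h1 : (e + δ) * (1 + f j * p) = (1 + f j * (p * ↑u⁻¹)) * (e + δ) := by
    have : δ * f j = 0 := hδ.mul_right_zero (D.mul_ne hjk.symm)
    have h2 : (u : A) * f j = f j := by rw [hu, add_mul, hej, this, add_zero]
    rw [← hu, mul_add, mul_one, ← mul_assoc, h2, add_mul, one_mul, mul_assoc, mul_assoc, u.inv_mul,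
      mul_one]
  exact h1 ▸ S.mul_mem hpS hd

theorem inv_mem' {a b : A} (ha : a ∈ S) (hab : a * b = 1) : b ∈ S ∧ b * a = 1 := by
  refine ⟨D.inv_mem _ _ ha hab, ?_⟩
  obtain ⟨u, rfl⟩ := D.isUnit a ha
  rw [← Units.inv_eq_of_mul_eq_one_right hab, u.inv_mul]

theorem one_add_mul_corner_mul_mem {r : P} {a b α : A} (ha : a ∈ S) (hab : a * b = 1)
    (hu : UnitAt (f r) (f r + α)) : 1 + a * α * b ∈ S := by
  have h1 := D.unitAt_add_mem hu
  have h2 : a * (f r + α + (1 - f r)) * b = 1 + a * α * b := by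
    rw [show f r + α + (1 - f r) = 1 + α by abel, mul_add, add_mul, mul_one, hab]
  exact h2 ▸ S.mul_mem (S.mul_mem ha h1) (D.inv_mem _ _ ha hab)

/-- The entries `aᵢᵣ α (a⁻¹)ᵣⱼ`, for `a` in the group, define transvections in the group. -/
theorem one_add_conj_corner_mem {i j r : P} {a b α : A} (hij : i ≠ j) (ha : a ∈ S)
    (hab : a * b = 1) (hα : Block (f r) (f r) α) : 1 + f i * a * α * b * f j ∈ S := by
  -- If this link vanishes, so does the entry in question. Otherwise it transports invertibility of
  -- central scalars from the corner of `f r` to that of `f j`.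
  by_cases hv0 : f r * b * f j = 0
  · have : f i * a * α * b * f j = f i * a * α * (f r * b * f j) := by
      conv_lhs => rw [← hα.2]
      simp only [mul_assoc]
    rw [this, hv0, mul_zero, add_zero]
    exact S.one_mem
  have hg := D.idem j
  have hr := D.idem r
  have hrb := Block.self hr
  have hrnil := (D.loc r).not_isNilpotent
  obtain ⟨hbS, hba⟩ := D.inv_mem' ha hab
  have hv := Block.mk' hr hg b
  obtain ⟨w, hwdef⟩ : ∃ w, w = f r * (b * f j * a) * f r := ⟨_, rfl⟩
  have hw : Block (f r) (f r) w := hwdef ▸ Block.mk' hr hr _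
  have comm_r : ∀ x, Block (f r) (f r) x → Commute x (f r) := fun x hx => hx.2.trans hx.1.symm
  obtain ⟨s, hs⟩ := (D.loc r).exists_smul_add_unitAt (k := 2) (by omega)
    ![f r, α] ![0, f r] (by simp [Fin.forall_fin_two, hrb, hα])
    (by simp [Fin.forall_fin_two, hrb, Block.zero])
    (by simp [Fin.forall_fin_two, comm_r α hα]) (by simp [Fin.forall_fin_two, hrnil])
  have hs0 : UnitAt (f r) (s • f r) := by simpa using hs 0
  have hs1 : UnitAt (f r) (s • α + f r) := hs 1
  obtain ⟨α', hα'⟩ : ∃ α', α' = s • α := ⟨_, rfl⟩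
  rw [← hα'] at hs1
  have hαb : Block (f r) (f r) α' := hα' ▸ hα.smul s
  obtain ⟨y, hy⟩ := hs1
  have hαw := hαb.mul hw
  have hyαw := hy.right.mul hαw
  -- The invertible elements are `c`, `c + 1`, `1 + c α' w` and `1 + c y α' w`. Multiplied by `1 +
  -- α'`, whose inverse is `y`, the last becomes `1 + α' + c α' w`, the element to be inverted in
  -- the definition of `β`.
  obtain ⟨c, hc⟩ := (D.loc r).exists_smul_add_unitAt (k := 4) (by omega)
    ![f r, f r, α' * w, y * (α' * w)] ![0, f r, f r, f r]
    (by simp [Fin.forall_fin_succ, hrb, hαw, hyαw])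
    (by simp [Fin.forall_fin_succ, hrb, Block.zero])
    (by simp [Fin.forall_fin_succ, comm_r _ hαw, comm_r _ hyαw])
    (by simp [Fin.forall_fin_succ, hrnil])
  have hc0 : UnitAt (f r) (c • f r) := by simpa using hc 0
  have hc1 : UnitAt (f r) ((c + 1) • f r) := by
    rw [add_smul, one_smul]
    exact hc 1
  have hc2 : UnitAt (f r) (c • (α' * w) + f r) := hc 2
  have hc3 : UnitAt (f r) (f r + α' + c • (α' * w)) := by
    have h1 := UnitAt.mul ⟨_, hy⟩ (hc 3)
    have h2 : (α' + f r) * (c • (y * (α' * w)) + f r) = f r + α' + c • (α' * w) := by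
      rw [mul_add, mul_smul_comm, ← mul_assoc _ y, hy.mul, hαw.1, add_mul, hαb.2, hr]
      abel
    exact h2 ▸ h1
  obtain ⟨κ, hκ⟩ := hc3
  -- This solves `α' + β + α' β + c α' w β = 0`. In the product formed in `hx` that sum is the
  -- coefficient of everything lying outside the row and column of `f j`, so the product differs
  -- from `1` only there.
  obtain ⟨β, hβdef⟩ : ∃ β, β = -(κ * α') := ⟨_, rfl⟩
  have hβ : Block (f r) (f r) β := hβdef ▸ (hκ.right.mul hαb).neg
  have hβu : UnitAt (f r) (f r + β) := by
    have h1 := UnitAt.mul ⟨_, hκ.symm⟩ hc2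
    have h2 : κ * (c • (α' * w) + f r) = f r + β := by
      have h3 : κ * (f r + α' + c • (α' * w)) = f r := hκ.mul'
      rw [hβdef]
      nth_rewrite 2 [← h3]
      simp only [mul_add]
      abel
    exact h2 ▸ h1
  have hsum : α' + β + α' * β + c • (α' * w * β) = 0 := by
    have h1 : (f r + α' + c • (α' * w)) * β = -α' := by
      rw [hβdef, mul_neg, ← mul_assoc, hκ.mul, hαb.1]
    rw [add_mul, add_mul, hβ.1, smul_mul_assoc] at h1
    rw [add_assoc, add_assoc, ← add_assoc β, h1, add_neg_cancel]
  have hx1 := D.one_add_mul_corner_mul_mem ha hab (by rw [add_comm]; exact ⟨y, hy⟩)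
  have hx3 := D.one_add_mul_corner_mul_mem ha hab hβu
  have transfer : ∀ c : C, UnitAt (f r) (c • f r) → UnitAt (f j) (c • f j) := fun c hc =>
    (D.loc j).unitAt_smul_of_block (Or.inl hv) hv0 hc
  have hx2 : 1 + c • f j ∈ S := by
    have := D.smul_unit_mem (transfer _ hc1)
    rwa [add_sub_cancel_right] at this
  have hαf : α' * (b * (f j * (a * β))) = α' * w * β := by
    conv_lhs => rw [← hαb.2, ← hβ.1]
    rw [hwdef]
    simp only [mul_assoc]
  have hx : (1 + a * α' * b) * (1 + c • f j) * (1 + a * β * b) =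
      1 + c • f j + c • (a * α' * b * f j) + c • (f j * a * β * b) := by
    have h1 : (1 + a * α' * b) * (1 + c • f j) * (1 + a * β * b) =
        1 + c • f j + c • (a * α' * b * f j) + c • (f j * a * β * b) +
          a * (α' + β + α' * β + c • (α' * w * β)) * b := by
      rw [← hαf]
      simp only [mul_add, add_mul, mul_one, one_mul, mul_assoc, smul_mul_assoc, mul_smul_comm,
        mul_assoc_of_eq hba]
      module
    rw [h1, hsum, mul_zero, zero_mul, add_zero]
  have hxS := S.mul_mem (S.mul_mem hx1 hx2) hx3
  rw [hx] at hxS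
  have hent := D.one_add_entry_mem hij hxS ?_
  · have hval : f i * (1 + c • f j + c • (a * α' * b * f j) + c • (f j * a * β * b)) * f j =
        (c * s) • (f i * a * α * b * f j) := by
      simp only [mul_add, add_mul, mul_one, one_mul, mul_assoc, smul_mul_assoc, mul_smul_comm, hg,
        hα', smul_smul, D.mul_ne hij, mul_assoc_of_eq (D.mul_ne hij), zero_mul, smul_zero]
      module
    rw [hval] at hent
    have hu : UnitAt (f j) ((c * s) • f j) := by
      have := (transfer _ hc0).mul (transfer _ hs0)
      rwa [smul_mul_assoc, mul_smul_comm, hg, smul_smul] at this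
    have hb : Block (f i) (f j) (f i * a * α * b * f j) := by
      simpa only [mul_assoc] using Block.mk' (D.idem i) hg (a * α * b)
    obtain ⟨z, hz⟩ := hu
    have h1 := D.mul_unit_mem hij (hb.smul _) hent ⟨_, hz.symm⟩
    rwa [smul_mul_assoc, ← mul_smul_comm, ← hz.right.1, ← smul_mul_assoc, hz.mul, hb.2] at h1
  · simp only [mul_add, add_mul, mul_sub, sub_mul, mul_one, one_mul, mul_assoc, smul_mul_assoc,
      mul_smul_comm, hg, mul_assoc_of_eq hg]
    module

end DiagonalFrame

end Normality

/-! ### The net of a group: stability under conjugation and Gauss elimination. -/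

section NetEntries

variable {C A P : Type*} [CommRing C] [Ring A] [Algebra C A] [Fintype P]

/-- All off-diagonal entries of `x` define transvections in `S`. -/
def NetEntries (f : P → A) (S : Submonoid A) (x : A) : Prop :=
  ∀ p q, p ≠ q → 1 + f p * x * f q ∈ S

theorem LocalIdem.unitAt_right {e x y : A} (he : LocalIdem C e) (hx : Block e e x)
    (hy : Block e e y) (h : UnitAt e (x * y)) : UnitAt e y := by
  obtain ⟨z, hz⟩ := he.unitAt_of_mul_eq hx h
  have := UnitAt.mul ⟨_, hz.symm⟩ h
  rwa [← mul_assoc, hz.mul', hy.1] at this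

namespace DiagonalFrame

variable {f : P → A} {S : Submonoid A} (D : DiagonalFrame C f S)
include D

theorem entry_block (p q : P) (x : A) : Block (f p) (f q) (f p * x * f q) :=
  Block.mk' (D.idem p) (D.idem q) x

theorem sum_mem {ι : Type*} {p q : P} (hpq : p ≠ q) (s : Finset ι) (x : ι → A)
    (hx : ∀ i ∈ s, Block (f p) (f q) (x i)) (hS : ∀ i ∈ s, 1 + x i ∈ S) :
    1 + ∑ i ∈ s, x i ∈ S := by
  have := Finset.sum_induction x (fun y => Block (f p) (f q) y ∧ 1 + y ∈ S)
    (fun a b ha hb => ⟨ha.1.add hb.1, D.add_mem hpq ha.1 hb.1 ha.2 hb.2⟩)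
    ⟨Block.zero, by rw [add_zero]; exact S.one_mem⟩ (fun i hi => ⟨hx i hi, hS i hi⟩)
  exact this.2

/-- An entry of the product is a sum over a middle index. Middle indices equal to an end use
stability of transvections under the corner rings, the others use the commutator. -/
theorem netEntries_mul {x y : A} (hx : NetEntries f S x) (hy : NetEntries f S y) :
    NetEntries f S (x * y) := by
  intro p q hpq
  have h1 : f p * (x * y) * f q = ∑ r, (f p * x * f r) * (f r * y * f q) := by
    calc f p * (x * y) * f q = f p * x * (∑ r, f r) * (y * f q) := by
          rw [D.orth.complete, mul_one]; simp only [mul_assoc]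
      _ = _ := by
          rw [Finset.mul_sum, Finset.sum_mul]
          refine Finset.sum_congr rfl fun r _ => ?_
          conv_lhs => rw [← D.idem r]
          simp only [mul_assoc]
  rw [h1]
  refine D.sum_mem hpq _ _ (fun r _ => (D.entry_block p r x).mul (D.entry_block r q y))
    fun r _ => ?_
  by_cases hpr : p = r
  · subst hpr
    exact D.left_mul_mem hpq (D.entry_block _ _ _) (hy _ _ hpq) (D.entry_block _ _ _)
  · by_cases hrq : r = q
    · subst hrq
      exact D.right_mul_mem hpq (D.entry_block _ _ _) (hx _ _ hpq) (D.entry_block _ _ _)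
    · exact D.mul_mem hrq hpq (D.entry_block _ _ _) (D.entry_block _ _ _) (hx _ _ hpr)
        (hy _ _ hrq)

theorem netEntries_of_comm {x : A} (hx : ∀ p, f p * x = x * f p) : NetEntries f S x := by
  intro p q hpq
  rw [hx, mul_assoc, D.mul_ne hpq, mul_zero, add_zero]
  exact S.one_mem

theorem netEntries_add {x y : A} (hx : NetEntries f S x) (hy : NetEntries f S y) :
    NetEntries f S (x + y) := by
  intro p q hpq
  rw [mul_add, add_mul]
  exact D.add_mem hpq (D.entry_block _ _ _) (D.entry_block _ _ _) (hx p q hpq) (hy p q hpq)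

/-- The group normalizes the ring of all elements with entries in its net. -/
theorem netEntries_conj {a b x : A} (ha : a ∈ S) (hab : a * b = 1) (hx : NetEntries f S x) :
    NetEntries f S (a * x * b) := by
  intro i j hij
  have h1 : f i * (a * x * b) * f j =
      ∑ r, ∑ t, f i * (a * (f r * x * f t) * b) * f j := by
    calc f i * (a * x * b) * f j = f i * a * ((∑ r, f r) * x * ∑ t, f t) * b * f j := by
          rw [D.orth.complete, mul_one, one_mul]; simp only [mul_assoc]
      _ = _ := by
          rw [Finset.sum_mul, Finset.sum_mul_sum]
          simp only [Finset.mul_sum, Finset.sum_mul]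
          refine Finset.sum_congr rfl fun r _ => Finset.sum_congr rfl fun t _ => ?_
          simp only [mul_assoc]
  rw [h1, ← Finset.sum_product']
  refine D.sum_mem hij _ _ (fun _ _ => D.entry_block _ _ _) ?_
  rintro ⟨r, t⟩ -
  have hy := D.entry_block r t x
  simp only
  by_cases hrt : r = t
  · subst hrt
    have := D.one_add_conj_corner_mem hij ha hab hy
    simpa only [mul_assoc] using this
  · have hyS := hx r t hrt
    generalize f r * x * f t = y at *
    have hyy := hy.mul_eq_zero hy (D.mul_ne (Ne.symm hrt))
    have hty : f t * y = 0 := hy.mul_left_zero (D.mul_ne (Ne.symm hrt))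
    have hinv : a * (1 + y) * ((1 - y) * b) = 1 := by
      have : (1 + y) * (1 - y) = 1 := by
        rw [mul_sub, mul_one, add_mul, one_mul, hyy, add_zero, add_sub_cancel_right]
      rw [mul_assoc, ← mul_assoc (1 + y), this, one_mul, hab]
    have htb := Block.self (D.idem t)
    have k1 := D.one_add_conj_corner_mem hij (S.mul_mem ha hyS) hinv htb
    have k2 := D.one_add_conj_corner_mem hij ha hab htb
    -- An off-diagonal entry reduces to diagonal corners: `(1 + y) f t (1 - y) = f t + y`, so `a y
    -- b` is the difference of the conjugates of `f t` by `a (1 + y)` and by `a`.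
    have hsub : f i * (a * y * b) * f j =
        f i * (a * (1 + y)) * f t * ((1 - y) * b) * f j - f i * a * f t * b * f j := by
      simp only [mul_add, add_mul, mul_sub, sub_mul, mul_one, one_mul, mul_assoc, hy.2, hyy, hty,
        mul_assoc_of_eq hy.2, mul_assoc_of_eq hyy, mul_assoc_of_eq hty, mul_zero, zero_mul]
      abel
    rw [hsub]
    refine D.sub_mem hij ?_ ?_ k1 k2
    · simpa only [mul_assoc] using D.entry_block i j (a * (1 + y) * f t * ((1 - y) * b))
    · simpa only [mul_assoc] using D.entry_block i j (a * f t * b)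

theorem netEntries_col {k : P} {p : A} (hp : Block (1 - f k) (f k) p)
    (h : ∀ j, j ≠ k → 1 + f j * p ∈ S) : NetEntries f S (1 + p) := by
  refine D.netEntries_add (D.netEntries_of_comm fun _ => by rw [mul_one, one_mul]) ?_
  intro i j hij
  by_cases hj : j = k
  · subst hj
    rw [mul_assoc, hp.2]
    exact h i hij
  · rw [mul_assoc, hp.mul_right_zero (D.mul_ne (Ne.symm hj)), mul_zero, add_zero]
    exact S.one_mem

theorem netEntries_row {k : P} {q : A} (hq : Block (f k) (1 - f k) q)
    (h : ∀ j, j ≠ k → 1 + q * f j ∈ S) : NetEntries f S (1 + q) := by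
  refine D.netEntries_add (D.netEntries_of_comm fun _ => by rw [mul_one, one_mul]) ?_
  intro i j hij
  by_cases hi : i = k
  · subst hi
    rw [hq.1]
    exact h j (Ne.symm hij)
  · rw [hq.mul_left_zero (D.mul_ne hi), zero_mul, add_zero]
    exact S.one_mem

/-- The terms `g'_{pq} g_{qp}` sum to `f p`, so one of them is a unit because the corner is local.
If `g_{pp}` is not a unit, then `q ≠ p`, and adding `g'_{pq}` times row `q` to row `p` makes the
pivot a nonunit plus a unit. An index `q` already cleared would give a zero term, so cleared rows
and columns are untouched. -/
theorem exists_pivot {p : P} {s : Finset P} (g g' : A) (h' : g' * g = 1)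
    (hg' : NetEntries f S g')
    (hs : ∀ r, r ≠ p → r ∉ s → g * f r = f r ∧ f r * g = f r) :
    ∃ t t', t ∈ S ∧ t * t' = 1 ∧ t' * t = 1 ∧ NetEntries f S t ∧ NetEntries f S t' ∧
      UnitAt (f p) (f p * (t * g) * f p) ∧
      ∀ r, r ≠ p → r ∉ s → t * g * f r = f r ∧ f r * (t * g) = f r := by
  have hM1 : NetEntries f S (1 : A) := D.netEntries_of_comm fun _ => by rw [mul_one, one_mul]
  by_cases hpp : UnitAt (f p) (f p * g * f p)
  · exact ⟨1, 1, S.one_mem, mul_one _, mul_one _, hM1, hM1, by rwa [one_mul], by simpa using hs⟩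
  have hsum : ∑ q, (f p * g' * f q) * (f q * g * f p) = f p := by
    calc ∑ q, (f p * g' * f q) * (f q * g * f p) = f p * g' * (∑ q, f q) * (g * f p) := by
          rw [Finset.mul_sum, Finset.sum_mul]
          refine Finset.sum_congr rfl fun r _ => ?_
          conv_rhs => rw [← D.idem r]
          simp only [mul_assoc]
      _ = f p := by
          rw [D.orth.complete, mul_one, mul_assoc, mul_assoc_of_eq h', one_mul, D.idem]
  obtain ⟨q, -, hq⟩ := (D.loc p).exists_unitAt_of_sum Finset.univ
    (fun q => (f p * g' * f q) * (f q * g * f p))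
    (fun q _ => (D.entry_block p q g').mul (D.entry_block q p g))
    (hsum.symm ▸ (D.loc p).unitAt_self)
  have hqp : q ≠ p := by
    rintro rfl
    exact hpp ((D.loc q).unitAt_right (D.entry_block _ _ _) (D.entry_block _ _ _) hq)
  have hxb := D.entry_block p q g'
  have hxS := hg' p q hqp.symm
  have hxx := hxb.mul_eq_zero hxb (D.mul_ne hqp)
  have hx1 : f p * (f p * g' * f q * g) * f p = (f p * g' * f q) * (f q * g * f p) := by
    conv_rhs => rw [← hxb.1]
    simp only [mul_assoc]
    rw [mul_assoc_of_eq (D.idem q)]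
  rw [← hx1] at hq
  have hM : NetEntries f S (f p * g' * f q) := by
    intro i j hij
    by_cases hi : i = p
    · by_cases hj : j = q
      · rw [hi, hj, hxb.1, hxb.2]
        exact hxS
      · rw [mul_assoc, hxb.mul_right_zero (D.mul_ne (Ne.symm hj)), mul_zero, add_zero]
        exact S.one_mem
    · rw [hxb.mul_left_zero (D.mul_ne hi), zero_mul, add_zero]
      exact S.one_mem
  generalize f p * g' * f q = x at *
  have hMneg : NetEntries f S (-x) := by
    intro i j hij
    rw [mul_neg, neg_mul]
    exact D.neg_mem hij (D.entry_block _ _ _) (hM i j hij)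
  refine ⟨1 + x, 1 + -x, hxS, ?_, ?_, D.netEntries_add hM1 hM, D.netEntries_add hM1 hMneg, ?_, ?_⟩
  · simp only [mul_add, add_mul, mul_one, one_mul, mul_neg, hxx]
    abel
  · simp only [mul_add, add_mul, mul_one, one_mul, neg_mul, hxx]
    abel
  · have hb1 := D.entry_block p p ((1 + x) * g)
    have hb2 := (D.entry_block p p g).neg
    have h1 : f p * ((1 + x) * g) * f p + -(f p * g * f p) = f p * (x * g) * f p := by
      noncomm_ring
    rcases (D.loc p).unitAt_or_of_add hb1 hb2 (h1 ▸ hq) with h | h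
    · exact h
    · exact absurd (neg_neg (f p * g * f p) ▸ h.neg) hpp
  · intro r hrp hrs
    obtain ⟨h1, h2⟩ := hs r hrp hrs
    have hrq : q ≠ r := by
      rintro rfl
      have : f p * (x * g) * f p = 0 := by
        rw [← hxb.2, mul_assoc x, h2, hxb.2, mul_assoc, hxb.mul_right_zero (D.mul_ne hrp), mul_zero]
      rw [this] at hq
      exact hq.not_isNilpotent (D.loc p).not_isNilpotent IsNilpotent.zero
    refine ⟨?_, ?_⟩
    · rw [mul_assoc, h1, add_mul, one_mul, hxb.mul_right_zero (D.mul_ne hrq), add_zero]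
    · rw [← mul_assoc, mul_add, mul_one, hxb.mul_left_zero (D.mul_ne hrp), add_zero, h2]

/-- Gauss elimination: invertible elements with entries in the net lie in the group. -/
theorem mem_of_netEntries {g g' : A} (h : g * g' = 1) (h' : g' * g = 1) (hg : NetEntries f S g)
    (hg' : NetEntries f S g') : g ∈ S := by
  classical
  -- The set `s` contains the indices not yet cleared: outside `s` the rows and columns of `g` are
  -- those of `1`.
  have key : ∀ (s : Finset P) (g g' : A), g * g' = 1 → g' * g = 1 → NetEntries f S g →
      NetEntries f S g' → (∀ r, r ∉ s → g * f r = f r ∧ f r * g = f r) → g ∈ S := by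
    intro s
    induction s using Finset.induction_on with
    | empty =>
      intro g g' _ _ _ _ hr
      have : g = 1 := by
        rw [← mul_one g, ← D.orth.complete, Finset.mul_sum]
        exact Finset.sum_congr rfl fun r _ => (hr r (Finset.notMem_empty r)).1
      exact this ▸ S.one_mem
    | insert p s hps ih =>
      intro g₀ g₀' h₀ h₀' hg₀ hg₀' hr₀
      obtain ⟨t, t', htS, htt', ht't, htM, htM', hpiv, hr⟩ := D.exists_pivot (p := p) (s := s) g₀ g₀' h₀'
        hg₀' (fun r hrp hrs => hr₀ r (by simp [hrp, hrs]))
      refine D.mem_of_mul_mem_left htS ?_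
      have hg := D.netEntries_mul htM hg₀
      have hg' := D.netEntries_mul hg₀' htM'
      have h : t * g₀ * (g₀' * t') = 1 := by
        rw [mul_assoc, mul_assoc_of_eq h₀, one_mul, htt']
      have h' : g₀' * t' * (t * g₀) = 1 := by
        rw [mul_assoc, mul_assoc_of_eq ht't, one_mul, h₀']
      generalize t * g₀ = g at *
      generalize g₀' * t' = g' at *
      clear hr₀
      have hg1 := D.idem p
      obtain ⟨a', ha⟩ := hpiv
      obtain ⟨e, he⟩ : ∃ e, e = 1 - f p := ⟨_, rfl⟩
      have hee : e * e = e := by simp only [he, mul_sub, sub_mul, mul_one, one_mul, hg1]; abel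
      have hef : e * f p = 0 := by rw [he, sub_mul, hg1, one_mul, sub_self]
      have hfe : f p * e = 0 := by rw [he, mul_sub, hg1, mul_one, sub_self]
      have hsum : e + f p = 1 := by rw [he, sub_add_cancel]
      have hej : ∀ j, j ≠ p → f j * e = f j := fun j hj => by
        rw [he, mul_sub, D.mul_ne hj, mul_one, sub_zero]
      have hje : ∀ j, j ≠ p → e * f j = f j := fun j hj => by
        rw [he, sub_mul, D.mul_ne (Ne.symm hj), one_mul, sub_zero]
      have hcol := (Block.mk' hee hg1 g).mul ha.right
      have hrow := ha.right.mul (Block.mk' hg1 hee g)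
      have hcolS : ∀ j, j ≠ p → 1 + f j * (e * g * f p * a') ∈ S := by
        intro j hj
        have := D.right_mul_mem hj (D.entry_block j p g) (hg j p hj) ha.right
        simpa only [← mul_assoc, hej j hj] using this
      have hrowS : ∀ j, j ≠ p → 1 + a' * (f p * g * e) * f j ∈ S := by
        intro j hj
        have := D.left_mul_mem (Ne.symm hj) (D.entry_block p j g) (hg p j (Ne.symm hj)) ha.right
        simpa only [mul_assoc, hje j hj] using this
      have hcolneg : ∀ j, j ≠ p → 1 + f j * -(e * g * f p * a') ∈ S := by
        intro j hj
        rw [mul_neg]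
        refine D.neg_mem hj ⟨?_, ?_⟩ (hcolS j hj)
        · rw [← mul_assoc, D.idem]
        · rw [mul_assoc, hcol.2]
      have hrowneg : ∀ j, j ≠ p → 1 + -(a' * (f p * g * e)) * f j ∈ S := by
        intro j hj
        rw [neg_mul]
        refine D.neg_mem (Ne.symm hj) ⟨?_, ?_⟩ (hrowS j hj)
        · rw [← mul_assoc, hrow.1]
        · rw [mul_assoc, D.idem]
      have hcg : e * g * f p * a' * f p * g * f p = e * g * f p := by
        have h1 : a' * (f p * g * f p) = f p := ha.mul'
        calc e * g * f p * a' * f p * g * f p = e * g * f p * (a' * (f p * g * f p)) := by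
              simp only [mul_assoc]
          _ = _ := by rw [h1, mul_assoc, hg1]
      have hgr : f p * g * (a' * (f p * g * e)) = f p * g * e := by
        have h1 : f p * g * f p * a' = f p := ha.mul
        calc f p * g * (a' * (f p * g * e)) = f p * g * f p * a' * (f p * g * e) := by
              conv_lhs => rw [← ha.right.1]
              simp only [mul_assoc]
          _ = _ := by rw [h1]; simp only [mul_assoc, mul_assoc_of_eq hg1]
      have hrfix : ∀ r, r ≠ p → r ∉ s → e * g * f p * a' * f r = 0 ∧
          f r * (e * g * f p * a') = 0 ∧ a' * (f p * g * e) * f r = 0 ∧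
          f r * (a' * (f p * g * e)) = 0 := by
        intro r hrp hrs
        obtain ⟨h1, h2⟩ := hr r hrp hrs
        refine ⟨hcol.mul_right_zero (D.mul_ne (Ne.symm hrp)), ?_, ?_,
          hrow.mul_left_zero (D.mul_ne hrp)⟩
        · rw [← mul_assoc, ← mul_assoc, ← mul_assoc, hej r hrp, h2, D.mul_ne hrp, zero_mul]
        · rw [mul_assoc, mul_assoc, hje r hrp, mul_assoc, h1, D.mul_ne (Ne.symm hrp), mul_zero]
      have hcc := hcol.mul_eq_zero hcol hfe
      have hrr := hrow.mul_eq_zero hrow hef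
      have hfc : f p * (e * g * f p * a') = 0 := hcol.mul_left_zero hfe
      have hrf : a' * (f p * g * e) * f p = 0 := hrow.mul_right_zero hef
      generalize hcdef : e * g * f p * a' = c at *
      generalize hrdef : a' * (f p * g * e) = w at *
      rw [he] at hcol hrow
      have hLS := D.one_add_col_mem_of_forall hcol.neg hcolneg
      have hRS := D.one_add_row_mem_of_forall hrow.neg hrowneg
      have hLM := D.netEntries_col hcol.neg hcolneg
      have hRM := D.netEntries_row hrow.neg hrowneg
      have hLM' := D.netEntries_col hcol hcolS
      have hRM' := D.netEntries_row hrow hrowS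
      rw [← he] at hcol hrow
      have hdu : ∀ x y : A, InvAt (f p) x y → (x + e) * (y + e) = 1 := by
        intro x y hxy
        rw [add_mul, mul_add, mul_add, hxy.mul, hee, ← hxy.left.2, mul_assoc, hfe, mul_zero,
          add_zero, ← hxy.right.1, ← mul_assoc, hef, zero_mul, zero_add, add_comm, hsum]
      have hdS : ∀ x, UnitAt (f p) x → x + e ∈ S := fun x hx => he ▸ D.unitAt_add_mem hx
      have hdM : ∀ x, Block (f p) (f p) x → NetEntries f S (x + e) := by
        refine fun x hx => D.netEntries_of_comm fun r => ?_
        rw [mul_add, add_mul, D.comm_of_block hx, he, mul_sub, sub_mul,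
          D.comm_of_block (Block.self hg1), mul_one, one_mul]
      have hc1 : (1 + -c) * (1 + c) = 1 := by
        simp only [mul_add, add_mul, mul_one, one_mul, neg_mul, hcc]; abel
      have hc2 : (1 + c) * (1 + -c) = 1 := by
        simp only [mul_add, add_mul, mul_one, one_mul, mul_neg, hcc]; abel
      have hw1 : (1 + -w) * (1 + w) = 1 := by
        simp only [mul_add, add_mul, mul_one, one_mul, neg_mul, hrr]; abel
      have hw2 : (1 + w) * (1 + -w) = 1 := by
        simp only [mul_add, add_mul, mul_one, one_mul, mul_neg, hrr]; abel
      -- The factors `1 - c` and `1 - w` clear the column and the row of the pivot, and `a'`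
      -- normalizes the pivot to `f p`, so only the indices in `s` remain.
      have hmain : (a' + e) * ((1 + -c) * g * (1 + -w)) ∈ S := by
        refine ih _ ((1 + w) * g' * (1 + c) * (f p * g * f p + e)) ?_ ?_ ?_ ?_ ?_
        · simp only [mul_assoc, mul_assoc_of_eq hw1, one_mul, mul_assoc_of_eq h,
            mul_assoc_of_eq hc1]
          simpa only [mul_assoc] using hdu _ _ ha.symm
        · have h1 := hdu _ _ ha
          rw [mul_assoc, mul_assoc_of_eq h1, one_mul, mul_assoc, mul_assoc, mul_assoc,
            mul_assoc_of_eq hc2, one_mul, mul_assoc_of_eq h', one_mul, hw2]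
        · exact D.netEntries_mul (hdM _ ha.right) (D.netEntries_mul (D.netEntries_mul hLM hg) hRM)
        · exact D.netEntries_mul (D.netEntries_mul (D.netEntries_mul hRM' hg') hLM') (hdM _ ha.left)
        · intro r hrs
          by_cases hrp : r = p
          · subst hrp
            have h1 : (1 + -c) * g * (1 + -w) * f r = f r * g * f r := by
              have h2 : c * g * f r = e * g * f r := by
                rw [← hcg, ← hcdef]
                conv_lhs => rw [← ha.right.2]
                simp only [mul_assoc]
              rw [mul_assoc _ (1 + -w), add_mul 1 (-w), neg_mul, hrf, neg_zero, add_zero, one_mul,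
                add_mul, add_mul, neg_mul, neg_mul, h2, one_mul, he]
              noncomm_ring
            have h3 : f r * ((1 + -c) * g * (1 + -w)) = f r * g * f r := by
              have h2 : f r * g * w = f r * g * e := hgr
              have h4 : f r * (1 + -c) = f r := by rw [mul_add, mul_neg, hfc, neg_zero, add_zero, mul_one]
              rw [← mul_assoc, ← mul_assoc, h4, mul_add, mul_neg, h2, he]
              noncomm_ring
            constructor
            · rw [mul_assoc, h1, add_mul, ha.mul', mul_assoc (f r), mul_assoc_of_eq hef, zero_mul,
                add_zero]
            · rw [← mul_assoc, mul_add, hfe, add_zero, ha.right.1, ← ha.right.2, mul_assoc, h3,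
                ha.mul']
          · obtain ⟨k1, k2, k3, k4⟩ := hrfix r hrp hrs
            obtain ⟨h1, h2⟩ := hr r hrp hrs
            have h5 := ha.right.mul_right_zero (D.mul_ne (Ne.symm hrp))
            have h6 := ha.right.mul_left_zero (D.mul_ne hrp)
            constructor
            · simp only [mul_add, add_mul, mul_one, one_mul, mul_assoc, neg_mul, mul_neg, k1, k3, h1,
                hje r hrp, h5, neg_zero, add_zero, zero_add, mul_zero]
            · simp only [mul_add, add_mul, mul_one, one_mul, ← mul_assoc, neg_mul, mul_neg, k2, k4,
                h2, hej r hrp, h6, neg_zero, add_zero, zero_add, zero_mul]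
      have h1 := D.mem_of_mul_mem_left (hdS _ ⟨_, ha.symm⟩) hmain
      exact D.mem_of_mul_mem_left hLS (D.mem_of_mul_mem_right hRS h1)
  exact key Finset.univ g g' h h' hg hg' fun r hr => absurd (Finset.mem_univ r) hr

end DiagonalFrame

end NetEntries

/-! ### Local idempotents and generation by units in Artinian rings. -/

section Artinian

/-- In the corner ring `e S e`, every element is nilpotent or invertible. -/
def NilOrUnit {S : Type*} [Ring S] (e : S) : Prop :=
  ∀ x, Block e e x → IsNilpotent x ∨ UnitAt e x

variable {S : Type*} [Ring S]

/-- Fitting's argument for right multiplication by `x`, a left linear endomorphism: its iterated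
images and kernels both stabilize, as an Artinian ring is also Noetherian. The exponent is positive
so that `x` itself can be split off from the power. -/
theorem exists_right_mul_stable [IsArtinianRing S] (x : S) :
    ∃ n, 0 < n ∧ (∃ t, x ^ n = t * (x ^ n * x ^ n)) ∧ ∀ z, z * (x ^ n * x ^ n) = 0 → z * x ^ n = 0 := by
  let φ : S →ₗ[S] S := LinearMap.toSpanSingleton S S x
  have hφ : ∀ m z, (φ ^ m) z = z * x ^ m := by
    intro m
    induction m with
    | zero => simp
    | succ m ih =>
      intro z
      rw [pow_succ', Module.End.mul_apply, ih, pow_succ, ← mul_assoc]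
      rfl
  obtain ⟨n₁, h₁⟩ := IsArtinian.monotone_stabilizes φ.iterateRange
  obtain ⟨n₂, h₂⟩ := monotone_stabilizes_iff_noetherian.2 (inferInstance : IsNoetherian S S)
    φ.iterateKer
  refine ⟨n₁ + n₂ + 1, by omega, ?_, ?_⟩
  · have h3 : LinearMap.range (φ ^ (n₁ + n₂ + 1)) =
        LinearMap.range (φ ^ ((n₁ + n₂ + 1) + (n₁ + n₂ + 1))) :=
      (h₁ (n₁ + n₂ + 1) (by omega)).symm.trans (h₁ ((n₁ + n₂ + 1) + (n₁ + n₂ + 1)) (by omega))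
    have h4 : x ^ (n₁ + n₂ + 1) ∈ LinearMap.range (φ ^ (n₁ + n₂ + 1)) := ⟨1, by rw [hφ, one_mul]⟩
    rw [h3] at h4
    obtain ⟨t, ht⟩ := h4
    refine ⟨t, ?_⟩
    exact ht.symm.trans (by rw [hφ, pow_add])
  · intro z hz
    have h3 := (h₂ (n₁ + n₂ + 1) (by omega)).symm.trans
      (h₂ ((n₁ + n₂ + 1) + (n₁ + n₂ + 1)) (by omega))
    have h4 : z ∈ φ.iterateKer ((n₁ + n₂ + 1) + (n₁ + n₂ + 1)) := by
      change (φ ^ _) z = 0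
      rw [hφ, pow_add, hz]
    rw [← h3] at h4
    have h5 : (φ ^ (n₁ + n₂ + 1)) z = 0 := h4
    rwa [hφ] at h5

/-- For a stable power `y` of `x` there is `s` in the corner with `y = s y²` and `y = y s y`, so `s
y` is idempotent. If it is `0`, then `x` is nilpotent; if it is `e`, then `x` is invertible. -/
theorem nilOrUnit_or_exists_idempotent [IsArtinianRing S] {e : S} (he : e * e = e) :
    NilOrUnit e ∨ ∃ g, Block e e g ∧ g * g = g ∧ g ≠ 0 ∧ g ≠ e := by
  by_contra! hcon
  obtain ⟨hx, hg⟩ := hcon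
  simp only [NilOrUnit, not_forall] at hx
  obtain ⟨x, hxb, hxn⟩ := hx
  push Not at hxn
  obtain ⟨n, hn, ⟨t, ht⟩, hz⟩ := exists_right_mul_stable x
  obtain ⟨m, rfl⟩ : ∃ m, n = m + 1 := ⟨n - 1, by omega⟩
  have hyb : Block e e (x ^ (m + 1)) := by
    refine ⟨?_, ?_⟩
    · rw [pow_succ', ← mul_assoc, hxb.1]
    · rw [pow_succ, mul_assoc, hxb.2]
  obtain ⟨y, hy⟩ : ∃ y, y = x ^ (m + 1) := ⟨_, rfl⟩
  rw [← hy] at hyb ht hz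
  have ht' : y = (e * t * e) * (y * y) := by
    conv_lhs => rw [← hyb.1, ht]
    rw [mul_assoc (e * t), ← mul_assoc e y, hyb.1, mul_assoc]
  have htb := Block.mk' he he t
  generalize e * t * e = s at *
  have hyy : y = y * s * y := by
    have h1 : (1 - y * s) * (y * y) = 0 := by
      rw [sub_mul, one_mul, mul_assoc, ← ht', sub_self]
    have h2 := hz _ h1
    rw [sub_mul, one_mul, sub_eq_zero] at h2
    exact h2
  have hgg : (s * y) * (s * y) = s * y := by
    rw [mul_assoc, ← mul_assoc y, ← hyy]
  by_cases hg0 : s * y = 0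
  · refine hxn.1 ⟨m + 1, ?_⟩
    rw [← hy, hyy, mul_assoc, hg0, mul_zero]
  · have hge := hg _ (htb.mul hyb) hgg hg0
    refine hxn.2 (UnitAt.of_mul_eq (y := x ^ m * s) (z := s * x ^ m) hxb ?_ ?_ ?_ ?_)
    · refine ⟨?_, by rw [mul_assoc, htb.2]⟩
      rcases m with _ | m
      · rw [pow_zero, one_mul, htb.1]
      · rw [pow_succ', mul_assoc, ← mul_assoc e, hxb.1]
    · refine ⟨by rw [← mul_assoc, htb.1], ?_⟩
      rcases m with _ | m
      · rw [pow_zero, mul_one, htb.2]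
      · rw [pow_succ, mul_assoc, mul_assoc, hxb.2]
    · rw [← mul_assoc, ← pow_succ', ← hy]
      have h1 : (e - y * s) * y = 0 := by
        rw [sub_mul, hyb.1, ← hyy, sub_self]
      have h2 : (e - y * s) * (s * (y * y)) = 0 := by
        rw [← ht', h1]
      have h3 : (e - y * s) * (s * y) = 0 := by
        rw [← mul_assoc] at h2 ⊢
        exact hz _ h2
      rw [hge, sub_mul, he, mul_assoc, htb.2, sub_eq_zero] at h3
      exact h3.symm
    · rw [mul_assoc, ← pow_succ, ← hy, hge]

/-- Splitting `e` into `g` and `e - g` strictly shrinks the left ideals generated, so the descending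
chain condition ends the process. -/
theorem exists_orthogonal_nilOrUnit [IsArtinianRing S] (e : S) (he : e * e = e) :
    ∃ (ι : Type) (_ : Fintype ι) (f : ι → S), OrthogonalIdempotents f ∧ ∑ i, f i = e ∧
      ∀ i, f i ≠ 0 ∧ NilOrUnit (f i) := by
  generalize hI : Ideal.span {e} = I
  induction I using WellFoundedLT.induction generalizing e with
  | ind I ih =>
  by_cases h0 : e = 0
  · exact ⟨Empty, inferInstance, Empty.elim, ⟨fun i => i.elim, fun i => i.elim⟩, by simp [h0],
      fun i => i.elim⟩
  rcases nilOrUnit_or_exists_idempotent he with h | ⟨g, hgb, hgg, hg0, hge⟩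
  · refine ⟨Unit, inferInstance, fun _ => e, ⟨fun _ => he, ?_⟩, by simp, fun _ => ⟨h0, h⟩⟩
    exact fun i j hij => absurd (Subsingleton.elim i j) hij
  · have hcomp : (e - g) * (e - g) = e - g := by
      rw [mul_sub, sub_mul, sub_mul, he, hgb.1, hgb.2, hgg, sub_self, sub_zero]
    have lt_of : ∀ k, k * e = k → e * k = k → k * k = k → k ≠ e → Ideal.span {k} < I := by
      intro k hke hek hkk hne
      rw [← hI]
      refine lt_of_le_of_ne ?_ fun heq => hne ?_
      · rw [Ideal.span_singleton_le_iff_mem, Ideal.mem_span_singleton']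
        exact ⟨k, hke⟩
      · have : e ∈ Ideal.span {k} := heq ▸ Ideal.mem_span_singleton_self e
        obtain ⟨s, hs⟩ := Ideal.mem_span_singleton'.1 this
        rw [← hek, ← hs, mul_assoc, hkk]
    obtain ⟨ι₁, _, f₁, ho₁, hs₁, hl₁⟩ := ih _ (lt_of g hgb.2 hgb.1 hgg hge) g hgg rfl
    obtain ⟨ι₂, _, f₂, ho₂, hs₂, hl₂⟩ := ih _ (lt_of (e - g) (by rw [sub_mul, he, hgb.2])
      (by rw [mul_sub, he, hgb.1]) hcomp (by simpa using hg0)) (e - g) hcomp rfl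
    have hsum : ∀ {ι : Type} [Fintype ι] (f : ι → S), OrthogonalIdempotents f → ∀ i,
        f i * ∑ j, f j = f i ∧ (∑ j, f j) * f i = f i := by
      intro ι _ f hf i
      classical
      constructor
      · rw [Finset.mul_sum, Finset.sum_eq_single i (fun j _ hji => hf.ortho (Ne.symm hji)) (by simp)]
        exact hf.idem i
      · rw [Finset.sum_mul, Finset.sum_eq_single i (fun j _ hji => hf.ortho hji) (by simp)]
        exact hf.idem i
    have hz1 : g * (e - g) = 0 := by rw [mul_sub, hgb.2, hgg, sub_self]
    have hz2 : (e - g) * g = 0 := by rw [sub_mul, hgb.1, hgg, sub_self]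
    have hb₁ : ∀ i, f₁ i * g = f₁ i ∧ g * f₁ i = f₁ i := fun i => hs₁ ▸ hsum f₁ ho₁ i
    have hb₂ : ∀ i, f₂ i * (e - g) = f₂ i ∧ (e - g) * f₂ i = f₂ i := fun i => hs₂ ▸ hsum f₂ ho₂ i
    refine ⟨ι₁ ⊕ ι₂, inferInstance, Sum.elim f₁ f₂, ⟨?_, ?_⟩, ?_, ?_⟩
    · rintro (i | i)
      · exact ho₁.idem i
      · exact ho₂.idem i
    · rintro (i | i) (j | j) hij
      · exact ho₁.ortho fun h => hij (congrArg _ h)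
      · change f₁ i * f₂ j = 0
        rw [← (hb₁ i).1, ← (hb₂ j).2, mul_assoc, ← mul_assoc g, hz1, zero_mul, mul_zero]
      · change f₂ i * f₁ j = 0
        rw [← (hb₂ i).1, ← (hb₁ j).2, mul_assoc, ← mul_assoc (e - g), hz2, zero_mul, mul_zero]
      · exact ho₂.ortho fun h => hij (congrArg _ h)
    · rw [Fintype.sum_sum_type]
      simp only [Sum.elim_inl, Sum.elim_inr, hs₁, hs₂, add_sub_cancel]
    · rintro (i | i)
      · exact hl₁ i
      · exact hl₂ i

variable {R : Type*} [Ring R]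

theorem isArtinianRing_mulOpposite [IsArtinian Rᵐᵒᵖ R] : IsArtinianRing Rᵐᵒᵖ := by
  let φ : R ≃ₗ[Rᵐᵒᵖ] Rᵐᵒᵖ :=
    { MulOpposite.opAddEquiv with
      map_smul' := fun r x => by
        simp [MulOpposite.smul_eq_mul_unop] }
  exact isArtinian_of_linearEquiv φ

theorem NilOrUnit.unop {e : Rᵐᵒᵖ} (h : NilOrUnit e) : NilOrUnit e.unop := by
  intro x hx
  have hx' : Block e e (MulOpposite.op x) :=
    ⟨MulOpposite.unop_injective hx.2, MulOpposite.unop_injective hx.1⟩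
  rcases h _ hx' with hn | ⟨y, hy⟩
  · left
    obtain ⟨k, hk⟩ := hn
    exact ⟨k, MulOpposite.op_injective (by rw [MulOpposite.op_pow, hk, MulOpposite.op_zero])⟩
  · right
    exact ⟨y.unop, hx, ⟨congrArg MulOpposite.unop hy.right.2, congrArg MulOpposite.unop hy.right.1⟩,
      congrArg MulOpposite.unop hy.mul', congrArg MulOpposite.unop hy.mul⟩

/-- A right Artinian ring has a complete family of orthogonal local idempotents. -/
theorem exists_complete_nilOrUnit [IsArtinian Rᵐᵒᵖ R] :
    ∃ (ι : Type) (_ : Fintype ι) (f : ι → R), CompleteOrthogonalIdempotents f ∧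
      ∀ i, f i ≠ 0 ∧ NilOrUnit (f i) := by
  have := isArtinianRing_mulOpposite (R := R)
  obtain ⟨ι, _, f, ho, hs, hl⟩ := exists_orthogonal_nilOrUnit (1 : Rᵐᵒᵖ) (mul_one 1)
  refine ⟨ι, inferInstance, fun i => (f i).unop, ⟨⟨fun i => ?_, fun i j hij => ?_⟩, ?_⟩,
    fun i => ⟨?_, (hl i).2.unop⟩⟩
  · exact congrArg MulOpposite.unop (ho.idem i)
  · exact congrArg MulOpposite.unop (ho.ortho (Ne.symm hij))
  · exact (map_sum (MulOpposite.opAddEquiv (α := R)).symm f _).symm.trans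
      (congrArg MulOpposite.unop hs)
  · simpa using (hl i).1

/-- The central `c` with `c • e` nilpotent form a proper ideal. Lifts of seven classes modulo a
maximal ideal containing it have differences outside that ideal. -/
theorem localIdem_of_center {e : R} (he : e * e = e) (h0 : e ≠ 0) (hl : NilOrUnit e)
    (hR : ∀ m : Ideal (Subring.center R), m.IsMaximal → 7 ≤ ENat.card (Subring.center R ⧸ m)) :
    LocalIdem (Subring.center R) e := by
  refine ⟨he, hl, ?_⟩
  let I : Ideal (Subring.center R) :=
    { carrier := {c | IsNilpotent (c • e)}
      zero_mem' := by simp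
      add_mem' := by
        intro a b ha hb
        have hc : Commute (a • e) (b • e) := ((Commute.refl e).smul_left a).smul_right b
        change IsNilpotent ((a + b) • e)
        rw [add_smul]
        exact hc.isNilpotent_add ha hb
      smul_mem' := by
        intro c a ha
        change IsNilpotent ((c * a) • e)
        rw [mul_smul]
        exact IsNilpotent.smul ha c }
  have hI : I ≠ ⊤ := by
    intro h
    have h1 : (1 : Subring.center R) ∈ I := h ▸ Submodule.mem_top
    have h2 : IsNilpotent ((1 : Subring.center R) • e) := h1
    rw [one_smul] at h2
    obtain ⟨k, hk⟩ := h2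
    rcases k with _ | k
    · rw [pow_zero] at hk
      exact h0 (by rw [← mul_one e, hk, mul_zero])
    · rw [IsIdempotentElem.pow_succ_eq k he] at hk
      exact h0 hk
  obtain ⟨m, hm, hIm⟩ := Ideal.exists_le_maximal I hI
  have hcard := hR m hm
  obtain ⟨T, hT⟩ : ∃ T : Finset (Subring.center R ⧸ m), T.card = 7 := by
    by_cases hfin : Finite (Subring.center R ⧸ m)
    · have := Fintype.ofFinite (Subring.center R ⧸ m)
      rw [ENat.card_eq_coe_fintype_card] at hcard
      have h7 : 7 ≤ Fintype.card (Subring.center R ⧸ m) := by exact_mod_cast hcard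
      obtain ⟨T, -, hT⟩ := Finset.exists_subset_card_eq (s := Finset.univ) h7
      exact ⟨T, hT⟩
    · have := not_finite_iff_infinite.1 hfin
      exact Infinite.exists_subset_card_eq _ 7
  let lift : Subring.center R ⧸ m → Subring.center R := Function.surjInv Ideal.Quotient.mk_surjective
  have hlift : ∀ a, Ideal.Quotient.mk m (lift a) = a := Function.surjInv_eq _
  refine ⟨T.map ⟨lift, (Function.LeftInverse.injective hlift)⟩, by rw [Finset.card_map, hT], ?_⟩
  intro s hs t ht hst hn
  rw [Finset.mem_map] at hs ht
  obtain ⟨a, -, rfl⟩ := hs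
  obtain ⟨b, -, rfl⟩ := ht
  have h1 : lift a - lift b ∈ m := hIm hn
  rw [← Ideal.Quotient.eq, hlift, hlift] at h1
  exact hst (h1 ▸ rfl)

/-- The units of `A` form the largest possible group in a diagonal frame. -/
theorem diagonalFrame_isUnit {C A P : Type*} [CommRing C] [Ring A] [Algebra C A] [Fintype P]
    {f : P → A} (ho : CompleteOrthogonalIdempotents f) (hl : ∀ p, LocalIdem C (f p)) :
    DiagonalFrame C f (IsUnit.submonoid A) where
  orth := ho
  loc := hl
  isUnit := fun _ h => h
  inv_mem := by
    rintro _ b ⟨u, rfl⟩ h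
    rw [← Units.inv_eq_of_mul_eq_one_right h]
    exact u⁻¹.isUnit
  diag_mem := fun _ h _ => h

/-- The ring is additively generated by its units. -/
theorem DiagonalFrame.mem_of_units_subset {C A P : Type*} [CommRing C] [Ring A] [Algebra C A]
    [Fintype P] {f : P → A} (D : DiagonalFrame C f (IsUnit.submonoid A)) (T : AddSubgroup A)
    (hT : ∀ a, IsUnit a → a ∈ T) (x : A) : x ∈ T := by
  have hx : x = ∑ p, ∑ q, f p * x * f q := by
    calc x = (∑ p, f p) * x * ∑ q, f q := by rw [D.orth.complete, one_mul, mul_one]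
      _ = _ := by rw [Finset.sum_mul, Finset.sum_mul_sum]
  rw [hx]
  refine _root_.sum_mem fun p _ => _root_.sum_mem fun q _ => ?_
  by_cases hpq : p = q
  · subst hpq
    have hy := D.entry_block p p x
    generalize f p * x * f p = y at *
    suffices h : ∃ y₁ y₂, UnitAt (f p) y₁ ∧ UnitAt (f p) y₂ ∧ y = y₁ - y₂ by
      obtain ⟨y₁, y₂, h₁, h₂, rfl⟩ := h
      rw [← add_sub_add_right_eq_sub y₁ y₂ (1 - f p)]
      exact T.sub_mem (hT _ (D.unitAt_add_mem h₁)) (hT _ (D.unitAt_add_mem h₂))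
    have hb := Block.self (D.idem p)
    rcases (D.loc p).dichotomy y hy with hn | hu
    · exact ⟨f p, f p - y, (D.loc p).unitAt_self, (D.loc p).unitAt_sub_of_isNilpotent hy hn,
        by abel⟩
    · obtain ⟨c, hc⟩ := (D.loc p).exists_smul_add_unitAt (k := 2) (by omega)
        ![f p, f p] ![0, -f p] (by simp [Fin.forall_fin_two, hb])
        (by simp [Fin.forall_fin_two, hb.neg, Block.zero]) (by simp [Fin.forall_fin_two])
        (by simp [Fin.forall_fin_two, (D.loc p).not_isNilpotent])
      have hc0 : UnitAt (f p) (c • f p) := by simpa using hc 0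
      have hc1 : UnitAt (f p) ((c - 1) • f p) := by
        rw [sub_smul, one_smul, sub_eq_add_neg]
        exact hc 1
      obtain ⟨z, hz⟩ := hc1
      have hzy := UnitAt.mul ⟨_, hz.symm⟩ hu
      -- With `z = (c - 1)⁻¹` in the corner, `y = c z y - z y` is a difference of two units.
      refine ⟨(c • f p) * (z * y), z * y, hc0.mul hzy, hzy, ?_⟩
      have h1 : (c - 1) • f p * z * y = y := by rw [hz.mul, hy.1]
      rw [← h1]
      nth_rewrite 2 [h1]
      nth_rewrite 2 [h1]
      rw [sub_smul, one_smul, sub_mul, sub_mul, hz.right.1, mul_assoc]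
  · have hb := D.entry_block p q x
    have h := T.sub_mem (hT _ (isUnit_one_add_of_mul_self (hb.mul_eq_zero hb (D.mul_ne (Ne.symm hpq)))))
      (hT 1 isUnit_one)
    rwa [add_sub_cancel_left] at h

end Artinian

/-! ### The frame in the matrix ring and the net of transvections of a subgroup. -/

section MatrixFrame

variable {n : ℕ} {R : Type*} [Ring R] {ι : Type} [Fintype ι]

theorem single_eq_of_block {i : Fin n} {e : R} {x : Matrix (Fin n) (Fin n) R}
    (hx : Block (single i i e) (single i i e) x) : x = single i i (e * x i i * e) := by
  conv_lhs => rw [← hx.2, ← hx.1]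
  rw [single_mul_mul_single]

theorem single_pow_succ (i : Fin n) (x : R) (k : ℕ) :
    single i i x ^ (k + 1) = single i i (x ^ (k + 1)) := by
  induction k with
  | zero => simp
  | succ k ih => rw [pow_succ, ih, single_mul_single_same, ← pow_succ]

theorem isNilpotent_single_iff {i : Fin n} {x : R} :
    IsNilpotent (single i i x) ↔ IsNilpotent x := by
  constructor
  · rintro ⟨k, hk⟩
    refine ⟨k + 1, ?_⟩
    have h : single i i x ^ (k + 1) = 0 := by rw [pow_succ, hk, zero_mul]
    rw [single_pow_succ] at h
    simpa using congrFun (congrFun h i) i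
  · rintro ⟨k, hk⟩
    exact ⟨k + 1, by rw [single_pow_succ, pow_succ, hk, zero_mul, single_zero]⟩

theorem block_single {i : Fin n} {e x : R} (hx : Block e e x) :
    Block (single i i e) (single i i e) (single i i x) :=
  ⟨by rw [single_mul_single_same, hx.1], by rw [single_mul_single_same, hx.2]⟩

theorem LocalIdem.single {C : Type*} [CommRing C] [Algebra C R] {e : R} (he : LocalIdem C e)
    (i : Fin n) : LocalIdem C (Matrix.single i i e) where
  idem := by rw [single_mul_single_same, he.idem]
  dichotomy := by
    intro x hx
    have hb := Block.mk' he.idem he.idem (x i i)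
    rw [single_eq_of_block hx, isNilpotent_single_iff]
    refine (he.dichotomy _ hb).imp_right ?_
    rintro ⟨y, hy⟩
    exact ⟨Matrix.single i i y, block_single hy.left, block_single hy.right,
      by rw [single_mul_single_same, hy.mul], by rw [single_mul_single_same, hy.mul']⟩
  large := by
    obtain ⟨T, hT, h⟩ := he.large
    refine ⟨T, hT, fun s hs t ht hst hn => h s hs t ht hst ?_⟩
    rwa [smul_single, isNilpotent_single_iff] at hn

theorem completeOrthogonalIdempotents_single {e : ι → R} (he : CompleteOrthogonalIdempotents e) :
    CompleteOrthogonalIdempotents fun p : Fin n × ι => (single p.1 p.1 (e p.2) : Matrix _ _ R) := by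
  refine ⟨⟨?_, ?_⟩, ?_⟩
  · rintro ⟨i, s⟩
    exact (single_mul_single_same _ _ _ _ _).trans (congrArg _ (he.idem s))
  · rintro ⟨i, s⟩ ⟨j, t⟩ h
    change single i i (e s) * single j j (e t) = 0
    by_cases hij : i = j
    · subst hij
      rw [single_mul_single_same, he.ortho (fun hst => h (Prod.ext rfl hst)), single_zero]
    · rw [single_mul_single_of_ne _ _ _ _ hij]
  · rw [Fintype.sum_prod_type]
    have : ∀ i : Fin n, ∑ s, (single i i (e s) : Matrix _ _ R) = single i i 1 := by
      intro i
      rw [← he.complete]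
      exact (map_sum (singleAddMonoidHom i i) e _).symm
    simp only [this]
    exact sum_single_one

/-- The matrices underlying the elements of a subgroup of `GL(n, R)`. -/
def matrixSet (F : Subgroup (GL (Fin n) R)) : Submonoid (Matrix (Fin n) (Fin n) R) :=
  F.toSubmonoid.map (Units.coeHom _)

theorem coe_mem_matrixSet {F : Subgroup (GL (Fin n) R)} {g : GL (Fin n) R} :
    (g : Matrix (Fin n) (Fin n) R) ∈ matrixSet F ↔ g ∈ F := by
  constructor
  · rintro ⟨g', hg', h⟩
    rwa [← Units.ext h]
  · exact fun h => ⟨g, h, rfl⟩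

theorem diagonal_mem_matrixSet {F : Subgroup (GL (Fin n) R)} (hF : diagGroup n R ≤ F)
    (d : Fin n → R) (hd : ∀ i, IsUnit (d i)) : diagonal d ∈ matrixSet F := by
  obtain ⟨u, hu⟩ := Pi.isUnit_iff.2 hd
  exact ⟨_, hF ⟨u, rfl⟩, by rw [← hu]; rfl⟩

theorem isUnit_of_isUnit_diagonal {d d' : Fin n → R} (h : diagonal d * diagonal d' = 1)
    (h' : diagonal d' * diagonal d = 1) (i : Fin n) : IsUnit (d i) := by
  rw [diagonal_mul_diagonal, ← diagonal_one] at h h'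
  exact ⟨⟨d i, d' i, congrFun (diagonal_injective h) i, congrFun (diagonal_injective h') i⟩, rfl⟩

theorem eq_diagonal_of_offDiag {x : Matrix (Fin n) (Fin n) R} (h : ∀ i j, i ≠ j → x i j = 0) :
    x = diagonal fun i => x i i := by
  ext i j
  by_cases hij : i = j
  · subst hij
    rw [diagonal_apply_eq]
  · rw [diagonal_apply_ne _ hij, h i j hij]

theorem mem_diagGroup_iff {g : GL (Fin n) R} :
    g ∈ diagGroup n R ↔ (∀ i j, i ≠ j → g.1 i j = 0) ∧ ∀ i j, i ≠ j → (g⁻¹).1 i j = 0 := by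
  constructor
  · rintro ⟨u, rfl⟩
    refine ⟨fun i j hij => ?_, fun i j hij => ?_⟩
    · exact diagonal_apply_ne _ hij
    · rw [← map_inv]
      exact diagonal_apply_ne _ hij
  · rintro ⟨h1, h2⟩
    have e1 := eq_diagonal_of_offDiag h1
    have e2 := eq_diagonal_of_offDiag h2
    have h3 := g.mul_inv
    have h4 := g.inv_mul
    rw [e1, e2] at h3 h4
    rw [← coe_mem_matrixSet, e1]
    exact diagonal_mem_matrixSet le_rfl _ (isUnit_of_isUnit_diagonal h3 h4)

/-- Commuting with all `e_s Eᵢᵢ` implies commuting with their sums `Eᵢᵢ`, hence being diagonal, so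
every such unit is in `D(n, R) ≤ F`. -/
theorem diagonalFrame_matrixSet {C : Type*} [CommRing C] [Algebra C R] {e : ι → R}
    (he : CompleteOrthogonalIdempotents e) (hl : ∀ s, LocalIdem C (e s))
    {F : Subgroup (GL (Fin n) R)} (hF : diagGroup n R ≤ F) :
    DiagonalFrame C (fun p : Fin n × ι => (single p.1 p.1 (e p.2) : Matrix _ _ R))
      (matrixSet F) where
  orth := completeOrthogonalIdempotents_single he
  loc := fun p => (hl p.2).single p.1
  isUnit := by
    rintro _ ⟨g, -, rfl⟩
    exact g.isUnit
  inv_mem := by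
    rintro _ b ⟨g, hg, rfl⟩ h
    have : b = ↑g⁻¹ := (Units.inv_eq_of_mul_eq_one_right h).symm
    rw [this]
    exact coe_mem_matrixSet.2 (F.inv_mem hg)
  diag_mem := by
    rintro _ ⟨g, rfl⟩ h
    have hsum : ∀ i, ∑ s, (single i i (e s) : Matrix (Fin n) (Fin n) R) = single i i 1 := by
      intro i
      rw [← he.complete]
      exact (map_sum (singleAddMonoidHom i i) e _).symm
    have hcomm : ∀ i, single i i 1 * g.1 = g.1 * single i i 1 := by
      intro i
      rw [← hsum, Finset.sum_mul, Finset.mul_sum]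
      exact Finset.sum_congr rfl fun s _ => h (i, s)
    have hoff : ∀ x : Matrix (Fin n) (Fin n) R, (∀ i, single i i 1 * x = x * single i i 1) →
        ∀ i j, i ≠ j → x i j = 0 := by
      intro x hx i j hij
      have := congrFun (congrFun (hx i) i) j
      rw [single_mul_apply_same, one_mul, mul_single_apply_of_ne _ _ _ _ _ (Ne.symm hij)] at this
      exact this
    refine coe_mem_matrixSet.2 (hF (mem_diagGroup_iff.2 ⟨hoff _ hcomm, hoff _ fun i => ?_⟩))
    exact ((show Commute (single i i 1) g.1 from hcomm i).units_inv_right).eq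

/-- The transvection `1 + a eᵢⱼ`. -/
def elementary {i j : Fin n} (hij : i ≠ j) (a : R) : GL (Fin n) R where
  val := 1 + single i j a
  inv := 1 - single i j a
  val_inv := by
    have : single i j a * single i j a = 0 := single_mul_single_of_ne _ _ _ _ (Ne.symm hij) _
    rw [mul_sub, mul_one, add_mul, this]
    simp
  inv_val := by
    have : single i j a * single i j a = 0 := single_mul_single_of_ne _ _ _ _ (Ne.symm hij) _
    rw [mul_add, mul_one, sub_mul, this]
    simp

theorem diagonal_mul_single (d : Fin n → R) (i j : Fin n) (x : R) :
    diagonal d * single i j x = single i j (d i * x) := by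
  ext k l
  rw [diagonal_mul, single_apply, single_apply]
  split_ifs with h
  · rw [h.1]
  · rw [mul_zero]

theorem single_mul_diagonal (d : Fin n → R) (i j : Fin n) (x : R) :
    single i j x * diagonal d = single i j (x * d j) := by
  ext k l
  rw [mul_diagonal, single_apply, single_apply]
  split_ifs with h
  · rw [h.2]
  · rw [zero_mul]

theorem one_add_single_diag (i : Fin n) (x : R) :
    1 + single i i x = diagonal (Function.update 1 i (1 + x)) := by
  ext k l
  rw [Matrix.add_apply, one_apply, single_apply, diagonal_apply]
  by_cases hkl : k = l
  · subst hkl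
    by_cases hk : i = k
    · subst hk; simp
    · simp [hk, Function.update_of_ne (Ne.symm hk)]
  · have : ¬ (i = k ∧ i = l) := fun h => hkl (h.1.symm.trans h.2)
    simp [hkl, this]

/-- The ring is additively generated by its units. -/
def UnitGenerated (R : Type*) [Ring R] : Prop :=
  ∀ T : AddSubgroup R, (∀ a, IsUnit a → a ∈ T) → ∀ x, x ∈ T

section Net

variable {F : Subgroup (GL (Fin n) R)}

theorem isUnit_update {i : Fin n} {u : R} (hu : IsUnit u) (k : Fin n) :
    IsUnit (Function.update (1 : Fin n → R) i u k) := by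
  by_cases h : k = i
  · subst h; simpa using hu
  · rw [Function.update_of_ne h]; exact isUnit_one

theorem matrixSet_add {i j : Fin n} (hij : i ≠ j) {x y : R}
    (hx : 1 + single i j x ∈ matrixSet F) (hy : 1 + single i j y ∈ matrixSet F) :
    1 + single i j (x + y) ∈ matrixSet F := by
  have : (1 + single i j x) * (1 + single i j y) = 1 + single i j (x + y) := by
    rw [mul_add, mul_one, add_mul, single_mul_single_of_ne _ _ _ _ (Ne.symm hij), single_add]
    simp [add_assoc]
  exact this ▸ mul_mem hx hy

theorem matrixSet_neg {i j : Fin n} (hij : i ≠ j) {x : R}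
    (hx : 1 + single i j x ∈ matrixSet F) : 1 + single i j (-x) ∈ matrixSet F := by
  have : (1 : Matrix (Fin n) (Fin n) R) + single i j (-x) = ↑(elementary hij x)⁻¹ := by
    change _ = 1 - single i j x
    rw [← single_neg, sub_eq_add_neg]
  rw [this, coe_mem_matrixSet]
  exact F.inv_mem (coe_mem_matrixSet.1 hx)

variable (hF : diagGroup n R ≤ F)
include hF

/-- For a unit `x` this is conjugation by a diagonal matrix; the admissible `x` form an additive
group, and units generate `R`. -/
theorem matrixSet_mul_left (hR : UnitGenerated R) {i j : Fin n} (hij : i ≠ j) {y : R}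
    (hy : 1 + single i j y ∈ matrixSet F) (x : R) : 1 + single i j (x * y) ∈ matrixSet F := by
  let T : AddSubgroup R :=
    { carrier := {x | 1 + single i j (x * y) ∈ matrixSet F}
      zero_mem' := by simp [one_mem]
      add_mem' := by
        intro a b ha hb
        change _ ∈ matrixSet F
        rw [add_mul]
        exact matrixSet_add hij ha hb
      neg_mem' := by
        intro a ha
        change _ ∈ matrixSet F
        rw [neg_mul]
        exact matrixSet_neg hij ha }
  refine hR T ?_ x
  rintro _ ⟨u, rfl⟩
  change _ ∈ matrixSet F
  have h1 := diagonal_mem_matrixSet hF _ (isUnit_update (i := i) u.isUnit)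
  have h2 := diagonal_mem_matrixSet hF _ (isUnit_update (i := i) (u⁻¹).isUnit)
  have h3 : diagonal (Function.update 1 i (u : R)) * (1 + single i j y) *
      diagonal (Function.update 1 i (↑u⁻¹ : R)) = 1 + single i j (u * y) := by
    rw [mul_add, add_mul, mul_one, diagonal_mul_diagonal, diagonal_mul_single, single_mul_diagonal,
      Function.update_self, Function.update_of_ne (Ne.symm hij), Pi.one_apply, mul_one,
      ← diagonal_one]
    congr 2
    ext k
    by_cases h : k = i
    · subst h; simp
    · simp [Function.update_of_ne h]
  exact h3 ▸ mul_mem (mul_mem h1 hy) h2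

theorem matrixSet_mul_right (hR : UnitGenerated R) {i j : Fin n} (hij : i ≠ j) {y : R}
    (hy : 1 + single i j y ∈ matrixSet F) (x : R) : 1 + single i j (y * x) ∈ matrixSet F := by
  let T : AddSubgroup R :=
    { carrier := {x | 1 + single i j (y * x) ∈ matrixSet F}
      zero_mem' := by simp [one_mem]
      add_mem' := by
        intro a b ha hb
        change _ ∈ matrixSet F
        rw [mul_add]
        exact matrixSet_add hij ha hb
      neg_mem' := by
        intro a ha
        change _ ∈ matrixSet F
        rw [mul_neg]
        exact matrixSet_neg hij ha }
  refine hR T ?_ x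
  rintro _ ⟨u, rfl⟩
  change _ ∈ matrixSet F
  have h1 := diagonal_mem_matrixSet hF _ (isUnit_update (i := j) u.isUnit)
  have h2 := diagonal_mem_matrixSet hF _ (isUnit_update (i := j) (u⁻¹).isUnit)
  have h3 : diagonal (Function.update 1 j (↑u⁻¹ : R)) * (1 + single i j y) *
      diagonal (Function.update 1 j (u : R)) = 1 + single i j (y * u) := by
    rw [mul_add, add_mul, mul_one, diagonal_mul_diagonal, diagonal_mul_single, single_mul_diagonal,
      Function.update_self, Function.update_of_ne hij, Pi.one_apply, one_mul,
      ← diagonal_one]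
    congr 2
    ext k
    by_cases h : k = j
    · subst h; simp
    · simp [Function.update_of_ne h]
  exact h3 ▸ mul_mem (mul_mem h2 hy) h1

/-- The `D`-net of all transvections in `F`. -/
def netOfSubgroup (hR : UnitGenerated R) : DNet n R where
  -- The guard `i ≠ j` makes the diagonal ideals equal to `R`.
  ideal i j := TwoSidedIdeal.mk' {a | i ≠ j → 1 + single i j a ∈ matrixSet F}
    (fun _ => by simp [one_mem])
    (fun ha hb hij => matrixSet_add hij (ha hij) (hb hij))
    (fun ha hij => matrixSet_neg hij (ha hij))
    (fun {x y} hy hij => matrixSet_mul_left hF hR hij (hy hij) x)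
    (fun {x y} hx hij => matrixSet_mul_right hF hR hij (hx hij) y)
  mul_mem := by
    intro i k j a ha b hb
    rw [TwoSidedIdeal.mem_mk'] at ha hb ⊢
    intro hij
    by_cases hik : i = k
    · subst hik
      exact matrixSet_mul_left hF hR hij (hb hij) a
    by_cases hkj : k = j
    · subst hkj
      exact matrixSet_mul_right hF hR hij (ha hij) b
    have hA := ha hik
    have hB := hb hkj
    have hA' := matrixSet_neg hik hA
    have hB' := matrixSet_neg hkj hB
    -- The commutator of two transvections realizes the product of their coefficients.
    have h : (1 + single i k a) * (1 + single k j b) * (1 + single i k (-a)) *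
        (1 + single k j (-b)) = 1 + single i j (a * b) := by
      simp only [mul_add, add_mul, mul_one, one_mul, mul_assoc, single_mul_single_same,
        single_mul_single_of_ne _ _ _ _ (Ne.symm hij), single_mul_single_of_ne _ _ _ _ (Ne.symm hik),
        single_mul_single_of_ne _ _ _ _ (Ne.symm hkj), mul_zero, zero_mul, neg_mul, mul_neg,
        ← single_neg]
      abel
    exact h ▸ mul_mem (mul_mem (mul_mem hA hB) hA') hB'
  diag i := by
    refine eq_top_iff.2 fun a _ => ?_
    rw [TwoSidedIdeal.mem_mk']
    exact fun h => absurd rfl h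

theorem mem_netOfSubgroup (hR : UnitGenerated R) {i j : Fin n} (hij : i ≠ j) {a : R} :
    a ∈ (netOfSubgroup hF hR).ideal i j ↔ 1 + single i j a ∈ matrixSet F := by
  simp only [netOfSubgroup, TwoSidedIdeal.mem_mk']
  exact ⟨fun h => h hij, fun h _ => h⟩

/-- The fine net indexed by pairs `(i, s)` carries no more information than the net of order `n`:
entries `e_s x e_t` with `s ≠ t` inside one diagonal position square to zero, so their transvections
are already in `D(n, R)`. -/
theorem netEntries_iff {e : ι → R} (he : CompleteOrthogonalIdempotents e) (hR : UnitGenerated R)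
    {g : Matrix (Fin n) (Fin n) R} :
    NetEntries (fun p : Fin n × ι => (single p.1 p.1 (e p.2) : Matrix _ _ R)) (matrixSet F) g ↔
      ∀ i j, g i j ∈ (netOfSubgroup hF hR).ideal i j := by
  constructor
  · intro h i j
    by_cases hij : i = j
    · subst hij
      rw [(netOfSubgroup hF hR).diag]
      trivial
    · have hsum : g i j = ∑ s, ∑ t, e s * g i j * e t := by
        calc g i j = (∑ s, e s) * g i j * ∑ t, e t := by rw [he.complete, one_mul, mul_one]
          _ = _ := by rw [Finset.sum_mul, Finset.sum_mul_sum]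
      rw [hsum]
      refine sum_mem fun s _ => sum_mem fun t _ => ?_
      rw [mem_netOfSubgroup hF hR hij]
      have := h (i, s) (j, t) (fun h' => hij (congrArg Prod.fst h'))
      rwa [single_mul_mul_single] at this
  · rintro h ⟨i, s⟩ ⟨j, t⟩ hpq
    simp only [single_mul_mul_single]
    by_cases hij : i = j
    · subst hij
      have hts : e t * e s = 0 := he.ortho fun h' => hpq (h' ▸ rfl)
      rw [one_add_single_diag]
      refine diagonal_mem_matrixSet hF _ (isUnit_update (isUnit_one_add_of_mul_self ?_))
      rw [mul_assoc, mul_assoc (e s), ← mul_assoc (e t), ← mul_assoc (e t), hts]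
      simp
    · rw [← mem_netOfSubgroup hF hR hij]
      exact ((netOfSubgroup hF hR).ideal i j).mul_mem_right _ _
        (((netOfSubgroup hF hR).ideal i j).mul_mem_left _ _ (h i j))

end Net

end MatrixFrame

/-! ### Submodules stable under the diagonal group, and their nets. -/

section Lattices

variable {n : ℕ} {R : Type*} [Ring R]

theorem glAction_eq_iff {g : GL (Fin n) R} {x : RightSubmodules n R} :
    glAction n R g x = x ↔ (∀ v ∈ x, g.1 *ᵥ v ∈ x) ∧ ∀ v ∈ x, (g⁻¹).1 *ᵥ v ∈ x := by
  have hmem : ∀ v, v ∈ glAction n R g x ↔ ∃ w ∈ x, g.1 *ᵥ w = v := fun v => Iff.rfl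
  have hinv : ∀ v : Fin n → R, (g⁻¹).1 *ᵥ (g.1 *ᵥ v) = v := (colEquiv g).left_inv
  have hinv' : ∀ v : Fin n → R, g.1 *ᵥ ((g⁻¹).1 *ᵥ v) = v := (colEquiv g).right_inv
  constructor
  · intro h
    refine ⟨fun v hv => h ▸ (hmem _).2 ⟨v, hv, rfl⟩, fun v hv => ?_⟩
    rw [← h, hmem] at hv
    obtain ⟨w, hw, rfl⟩ := hv
    rwa [hinv]
  · rintro ⟨h1, h2⟩
    ext v
    rw [hmem]
    constructor
    · rintro ⟨w, hw, rfl⟩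
      exact h1 w hw
    · exact fun hv => ⟨_, h2 v hv, hinv' v⟩

theorem mem_fixingGroup_iff {M : Sublattice (RightSubmodules n R)} {g : GL (Fin n) R} :
    g ∈ fixingGroup (glAction n R) M ↔
      ∀ x ∈ M, (∀ v ∈ x, g.1 *ᵥ v ∈ x) ∧ ∀ v ∈ x, (g⁻¹).1 *ᵥ v ∈ x :=
  forall₂_congr fun _ _ => glAction_eq_iff

theorem mem_fixedLattice_iff {F : Subgroup (GL (Fin n) R)} {x : RightSubmodules n R} :
    x ∈ fixedLattice (glAction n R) F ↔ ∀ g ∈ F, ∀ v ∈ x, g.1 *ᵥ v ∈ x := by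
  refine (forall₂_congr fun _ _ => glAction_eq_iff).trans ?_
  exact ⟨fun h g hg => (h g hg).1, fun h g hg => ⟨h g hg, h g⁻¹ (F.inv_mem hg)⟩⟩

theorem mem_span_single_iff {i : Fin n} {v : Fin n → R} :
    v ∈ Submodule.span Rᵐᵒᵖ {(Pi.single i 1 : Fin n → R)} ↔ ∀ k, k ≠ i → v k = 0 := by
  rw [Submodule.mem_span_singleton]
  constructor
  · rintro ⟨r, rfl⟩ k hk
    simp [Pi.single_eq_of_ne hk]
  · intro h
    refine ⟨MulOpposite.op (v i), ?_⟩
    ext k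
    by_cases hk : k = i
    · subst hk
      simp
    · simp [Pi.single_eq_of_ne hk, h k hk]

theorem fixingGroup_coordLattice :
    fixingGroup (glAction n R) (coordLattice n R) = diagGroup n R := by
  apply le_antisymm
  · intro g hg
    have hspan : ∀ i, Submodule.span Rᵐᵒᵖ {(Pi.single i 1 : Fin n → R)} ∈ coordLattice n R := by
      intro i
      rw [coordLattice, Sublattice.mem_sInf]
      exact fun K hK => hK i
    have h1 := fun i => mem_fixingGroup_iff.1 hg _ (hspan i)
    have hs : ∀ i, (Pi.single i 1 : Fin n → R) ∈
        Submodule.span Rᵐᵒᵖ {(Pi.single i 1 : Fin n → R)} :=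
      fun i => Submodule.mem_span_singleton_self _
    refine mem_diagGroup_iff.2 ⟨fun k i hki => ?_, fun k i hki => ?_⟩
    · have := mem_span_single_iff.1 ((h1 i).1 _ (hs i)) k hki
      rwa [mulVec_single_one] at this
    · have := mem_span_single_iff.1 ((h1 i).2 _ (hs i)) k hki
      rwa [mulVec_single_one] at this
  · have hle : coordLattice n R ≤ fixedLattice (glAction n R) (diagGroup n R) := by
      refine sInf_le fun i => mem_fixedLattice_iff.2 fun g hg v hv => ?_
      rw [mem_span_single_iff] at hv ⊢
      intro k hk
      have hd := (mem_diagGroup_iff.1 hg).1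
      change ∑ l, g.1 k l * v l = 0
      refine Finset.sum_eq_zero fun l _ => ?_
      by_cases hl : l = i
      · rw [hl, hd k i hk, zero_mul]
      · rw [hv l hl, mul_zero]
    exact fun g hg x hx => hle hx g hg

theorem mem_primeLattice_iff {x : RightSubmodules n R} :
    x ∈ primeLattice (glAction n R) (coordLattice n R) ↔
      ∀ d : Fin n → R, (∀ i, IsUnit (d i)) → ∀ v ∈ x, (fun i => d i * v i) ∈ x := by
  rw [primeLattice, fixingGroup_coordLattice, mem_fixedLattice_iff]
  constructor
  · intro h d hd v hv
    obtain ⟨g, hg, hgd⟩ := diagonal_mem_matrixSet (le_refl (diagGroup n R)) d hd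
    have := h g hg v hv
    rw [show g.1 = diagonal d from hgd] at this
    convert this using 1
    ext i
    rw [mulVec_diagonal]
  · rintro h _ ⟨u, rfl⟩ v hv
    have := h u.1 (Pi.isUnit_iff.1 u.isUnit) v hv
    convert this using 1
    ext i
    exact mulVec_diagonal _ _ _

/-- There are units `u`, `v` of `R` with `v = u - 1`. -/
def HasConsecutiveUnits (R : Type*) [Ring R] : Prop := ∃ u v : Rˣ, (v : R) = u - 1

section Prime

variable (hU : HasConsecutiveUnits R) {x : RightSubmodules n R}
  (hx : x ∈ primeLattice (glAction n R) (coordLattice n R))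
include hU hx

/-- Multiplying coordinate `i` by `u` and subtracting `v` leaves `(u - 1) vᵢ` in position `i` alone,
and `u - 1` is a unit that a diagonal matrix can undo. -/
theorem single_mem_of_mem {v : Fin n → R} (hv : v ∈ x) (i : Fin n) : Pi.single i (v i) ∈ x := by
  rw [mem_primeLattice_iff] at hx
  obtain ⟨u, w, hw⟩ := hU
  have h1 := hx _ (isUnit_update (i := i) u.isUnit) v hv
  have h2 := x.sub_mem h1 hv
  have h3 := hx _ (isUnit_update (i := i) (w⁻¹).isUnit) _ h2
  convert h3 using 1
  ext k
  by_cases hk : k = i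
  · subst hk
    simp only [Pi.single_eq_same, Function.update_self, Pi.sub_apply]
    rw [← sub_one_mul, ← hw, ← mul_assoc, w.inv_mul, one_mul]
  · simp [Pi.single_eq_of_ne hk, Function.update_of_ne hk]

theorem mem_component_iff {i : Fin n} {b : R} : b ∈ component x i ↔ Pi.single i b ∈ x := by
  constructor
  · rintro ⟨v, hv, rfl⟩
    exact single_mem_of_mem hU hx hv i
  · exact fun h => ⟨_, h, by simp⟩

theorem mem_iff_forall_component {v : Fin n → R} : v ∈ x ↔ ∀ i, v i ∈ component x i := by
  constructor
  · exact fun hv i => ⟨v, hv, rfl⟩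
  · intro h
    rw [← Finset.univ_sum_single v]
    exact sum_mem fun i _ => (mem_component_iff hU hx).1 (h i)

end Prime

theorem mul_mem_component (hR : UnitGenerated R) {x : RightSubmodules n R}
    (hx : x ∈ primeLattice (glAction n R) (coordLattice n R)) {i : Fin n} {b : R} (hb : b ∈ component x i) (a : R) :
    a * b ∈ component x i := by
  let T : AddSubgroup R :=
    { carrier := {a | a * b ∈ component x i}
      zero_mem' := by simp
      add_mem' := by
        intro a c ha hc
        change _ ∈ component x i
        rw [add_mul]
        exact (component x i).add_mem ha hc
      neg_mem' := by
        intro a ha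
        change _ ∈ component x i
        rw [neg_mul]
        exact (component x i).neg_mem ha }
  refine hR T (fun u hu => ?_) a
  change u * b ∈ component x i
  obtain ⟨v, hv, rfl⟩ := hb
  exact ⟨_, mem_primeLattice_iff.1 hx _ (isUnit_update (i := i) hu) v hv, by simp⟩

theorem mulVec_mem_of_net (hU : HasConsecutiveUnits R) {x : RightSubmodules n R}
    (hx : x ∈ primeLattice (glAction n R) (coordLattice n R)) {σ : DNet n R}
    (hσ : ∀ i j, ∀ a ∈ σ.ideal i j, ∀ b ∈ component x j, a * b ∈ component x i)
    {g : Matrix (Fin n) (Fin n) R} (hg : ∀ i j, g i j ∈ σ.ideal i j) {v : Fin n → R}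
    (hv : v ∈ x) : g *ᵥ v ∈ x := by
  rw [mem_iff_forall_component hU hx] at hv ⊢
  intro i
  change ∑ j, g i j * v j ∈ component x i
  exact sum_mem fun j _ => hσ i j _ (hg i j) _ (hv j)

theorem DNet.elementary_mem (σ : DNet n R) {i j : Fin n} (hij : i ≠ j) {a : R}
    (ha : a ∈ σ.ideal i j) : elementary hij a ∈ σ.group := by
  have h : ∀ b ∈ σ.ideal i j, ∀ k l,
      (1 + single i j b : Matrix (Fin n) (Fin n) R) k l ∈ σ.ideal k l := by
    intro b hb k l
    refine add_mem (σ.group.one_mem.1 k l) ?_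
    rw [single_apply]
    split_ifs with h
    · rw [← h.1, ← h.2]
      exact hb
    · exact zero_mem _
  refine ⟨h a ha, fun k l => ?_⟩
  have := h (-a) (neg_mem ha) k l
  rwa [← single_neg, ← sub_eq_add_neg] at this

theorem DNet.diagGroup_le (σ : DNet n R) : diagGroup n R ≤ σ.group := by
  have h : ∀ x : Matrix (Fin n) (Fin n) R, (∀ i j, i ≠ j → x i j = 0) →
      ∀ i j, x i j ∈ σ.ideal i j := by
    intro x hx i j
    by_cases hij : i = j
    · subst hij
      rw [σ.diag]
      trivial
    · rw [hx i j hij]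
      exact zero_mem _
  intro g hg
  exact ⟨h _ (mem_diagGroup_iff.1 hg).1, h _ (mem_diagGroup_iff.1 hg).2⟩

/-- The net of the multipliers of a sublattice of `L₀'`. -/
def netOfSublattice (hR : UnitGenerated R)
    (M : Sublattice (RightSubmodules n R))
    (hM : M ≤ primeLattice (glAction n R) (coordLattice n R)) : DNet n R where
  ideal i j := TwoSidedIdeal.mk' {a | ∀ x ∈ M, ∀ b ∈ component x j, a * b ∈ component x i}
    (fun x _ b _ => by rw [zero_mul]; exact zero_mem _)
    (fun ha hc x hx b hb => by rw [add_mul]; exact add_mem (ha x hx b hb) (hc x hx b hb))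
    (fun ha x hx b hb => by rw [neg_mul]; exact neg_mem (ha x hx b hb))
    (fun {r a} ha x hx b hb => by
      rw [mul_assoc]; exact mul_mem_component hR (hM hx) (ha x hx b hb) r)
    (fun {a r} ha x hx b hb => by
      rw [mul_assoc]; exact ha x hx _ (mul_mem_component hR (hM hx) hb r))
  mul_mem := by
    intro i k j a ha c hc
    rw [TwoSidedIdeal.mem_mk'] at ha hc ⊢
    intro x hx b hb
    rw [mul_assoc]
    exact ha x hx _ (hc x hx b hb)
  diag i := by
    refine eq_top_iff.2 fun a _ => ?_
    rw [TwoSidedIdeal.mem_mk']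
    exact fun x hx b hb => mul_mem_component hR (hM hx) hb a

theorem mem_netOfSublattice {hR : UnitGenerated R}
    {M : Sublattice (RightSubmodules n R)}
    {hM : M ≤ primeLattice (glAction n R) (coordLattice n R)} {i j : Fin n} {a : R} :
    a ∈ (netOfSublattice hR M hM).ideal i j ↔
      ∀ x ∈ M, ∀ b ∈ component x j, a * b ∈ component x i := by
  simp only [netOfSublattice, TwoSidedIdeal.mem_mk']
  rfl

/-- Applying `g` to a column with single entry `b ∈ xⱼ` in position `j` gives the entries `gᵢⱼ b`.
As `x` is the sum of its components, stability of `x` means that the `gᵢⱼ` are multipliers. -/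
theorem fixingGroup_eq_net (hR : UnitGenerated R) (hU : HasConsecutiveUnits R)
    (M : Sublattice (RightSubmodules n R))
    (hM : M ≤ primeLattice (glAction n R) (coordLattice n R)) :
    fixingGroup (glAction n R) M = (netOfSublattice hR M hM).group := by
  ext g
  rw [mem_fixingGroup_iff]
  constructor
  · intro h
    have key : ∀ A : Matrix (Fin n) (Fin n) R, (∀ x ∈ M, ∀ v ∈ x, A *ᵥ v ∈ x) →
        ∀ i j, A i j ∈ (netOfSublattice hR M hM).ideal i j := by
      intro A hA i j
      rw [mem_netOfSublattice]
      intro x hx b hb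
      have h1 := hA x hx _ ((mem_component_iff hU (hM hx)).1 hb)
      have h2 := (mem_iff_forall_component hU (hM hx)).1 h1 i
      rwa [mulVec_single] at h2
    exact ⟨key _ fun x hx => (h x hx).1, key _ fun x hx => (h x hx).2⟩
  · rintro ⟨h1, h2⟩ x hx
    have hσ : ∀ i j, ∀ a ∈ (netOfSublattice hR M hM).ideal i j, ∀ b ∈ component x j,
        a * b ∈ component x i := fun i j a ha => mem_netOfSublattice.1 ha x hx
    exact ⟨fun v hv => mulVec_mem_of_net hU (hM hx) hσ h1 hv,
      fun v hv => mulVec_mem_of_net hU (hM hx) hσ h2 hv⟩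

/-- For `i ≠ j`, invariance under the transvections in `G(σ)` already forces `σᵢⱼ xⱼ ⊆ xᵢ`; for `i =
j` the inclusion holds because `xᵢ` is two-sided. -/
theorem coe_primeFixed_group (hR : UnitGenerated R) (hU : HasConsecutiveUnits R) (σ : DNet n R) :
    (primeFixed (glAction n R) (coordLattice n R) σ.group : Set (RightSubmodules n R)) =
      σ.lattice := by
  ext x
  constructor
  · rintro ⟨hx, hfix⟩
    have hfix' := mem_fixedLattice_iff.1 hfix
    refine ⟨hx, fun i j a ha b hb => ?_⟩
    by_cases hij : i = j
    · subst hij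
      exact mul_mem_component hR hx hb a
    · have h1 := hfix' _ (σ.elementary_mem hij ha) _ ((mem_component_iff hU hx).1 hb)
      have h2 := (mem_iff_forall_component hU hx).1 h1 i
      change ((1 + single i j a) *ᵥ Pi.single j b) i ∈ _ at h2
      simpa [mulVec_single, one_apply_ne hij] using h2
  · rintro ⟨hx, hσ⟩
    exact ⟨hx, mem_fixedLattice_iff.2 fun g hg v hv => mulVec_mem_of_net hU hx hσ hg.1 hv⟩

/-- The submodule of columns whose entries lie in the `k`-th column of a net. -/
def DNet.column (σ : DNet n R) (k : Fin n) : RightSubmodules n R where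
  carrier := {v | ∀ i, v i ∈ σ.ideal i k}
  add_mem' := fun ha hb i => add_mem (ha i) (hb i)
  zero_mem' := fun _ => zero_mem _
  smul_mem' := fun _ _ hv i => (σ.ideal i k).mul_mem_right _ _ (hv i)

theorem DNet.column_mem_lattice (σ : DNet n R) (k : Fin n) : σ.column k ∈ σ.lattice := by
  refine ⟨mem_primeLattice_iff.2 fun d _ v hv i => (σ.ideal i k).mul_mem_left _ _ (hv i), ?_⟩
  rintro i j a ha _ ⟨v, hv, rfl⟩
  refine ⟨Pi.single i (a * v j), fun l => ?_, by simp⟩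
  by_cases hl : l = i
  · subst hl
    rw [Pi.single_eq_same]
    exact σ.mul_mem _ _ _ _ ha _ (hv j)
  · rw [Pi.single_eq_of_ne hl]
    exact zero_mem _

/-- The submodules `σ.column k` are fixed by `G(σ)` and the `k`-th contains the `k`-th basis vector,
so an element fixing them has its own columns in them. -/
theorem fixingGroup_primeFixed_group (hR : UnitGenerated R) (hU : HasConsecutiveUnits R)
    (σ : DNet n R) :
    fixingGroup (glAction n R) (primeFixed (glAction n R) (coordLattice n R) σ.group) =
      σ.group := by
  apply le_antisymm
  · intro g hg
    rw [mem_fixingGroup_iff] at hg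
    have key : ∀ A : Matrix (Fin n) (Fin n) R, (∀ k, ∀ v ∈ σ.column k, A *ᵥ v ∈ σ.column k) →
        ∀ i k, A i k ∈ σ.ideal i k := by
      intro A hA i k
      have h1 : (Pi.single k 1 : Fin n → R) ∈ σ.column k := by
        intro i
        by_cases hik : i = k
        · subst hik
          rw [σ.diag]
          trivial
        · rw [Pi.single_eq_of_ne hik]
          exact zero_mem _
      have h2 := hA k _ h1 i
      rwa [mulVec_single_one] at h2
    have hcol : ∀ k, σ.column k ∈ primeFixed (glAction n R) (coordLattice n R) σ.group := by
      intro k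
      have := σ.column_mem_lattice k
      rwa [← coe_primeFixed_group hR hU σ] at this
    exact ⟨key _ fun k => (hg _ (hcol k)).1, key _ fun k => (hg _ (hcol k)).2⟩
  · exact fun g hg x hx => hx.2 g hg

theorem isClosedSubgroup_iff (hR : UnitGenerated R) (hU : HasConsecutiveUnits R)
    (F : Subgroup (GL (Fin n) R)) :
    IsClosedSubgroup (glAction n R) (coordLattice n R) F ↔ ∃ σ : DNet n R, F = σ.group := by
  constructor
  · rintro ⟨-, h⟩
    exact ⟨_, h.symm.trans (fixingGroup_eq_net hR hU _ inf_le_left)⟩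
  · rintro ⟨σ, rfl⟩
    refine ⟨?_, fixingGroup_primeFixed_group hR hU σ⟩
    rw [fixingGroup_coordLattice]
    exact σ.diagGroup_le

theorem isClosedSublattice_iff (hR : UnitGenerated R) (hU : HasConsecutiveUnits R)
    (S : Set (RightSubmodules n R)) :
    (∃ M : Sublattice (RightSubmodules n R),
      IsClosedSublattice (glAction n R) (coordLattice n R) M ∧
        (M : Set (RightSubmodules n R)) = S) ↔ ∃ σ : DNet n R, S = σ.lattice := by
  constructor
  · rintro ⟨M, ⟨hM, h⟩, rfl⟩
    refine ⟨netOfSublattice hR M hM, ?_⟩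
    rw [← coe_primeFixed_group hR hU, ← fixingGroup_eq_net hR hU, h]
  · rintro ⟨σ, rfl⟩
    refine ⟨primeFixed (glAction n R) (coordLattice n R) σ.group, ⟨inf_le_left, ?_⟩,
      coe_primeFixed_group hR hU σ⟩
    rw [fixingGroup_primeFixed_group hR hU]

end Lattices

/-! ### The unique normal net subgroup of a group containing the diagonal group. -/

section NormalNet

variable {n : ℕ} {R : Type*} [Ring R]

theorem DNet.group_mono {σ τ : DNet n R} (h : ∀ i j, i ≠ j → ∀ a ∈ σ.ideal i j, a ∈ τ.ideal i j) :
    σ.group ≤ τ.group := by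
  have h' : ∀ i j, ∀ a ∈ σ.ideal i j, a ∈ τ.ideal i j := by
    intro i j a ha
    by_cases hij : i = j
    · subst hij
      rw [τ.diag]
      trivial
    · exact h i j hij a ha
  exact fun g hg => ⟨fun i j => h' _ _ _ (hg.1 i j), fun i j => h' _ _ _ (hg.2 i j)⟩

/-- A net subgroup which is normal in `F` is the net subgroup of the net of `F`. -/
theorem group_eq_of_isNormalIn {F : Subgroup (GL (Fin n) R)} (hF : diagGroup n R ≤ F)
    (hR : UnitGenerated R) (hU : HasConsecutiveUnits R) {τ : DNet n R}
    (hτ : IsNormalIn τ.group F) : τ.group = (netOfSubgroup hF hR).group := by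
  obtain ⟨hle, hnorm⟩ := hτ
  apply le_antisymm
  · refine DNet.group_mono fun i j hij a ha => ?_
    rw [mem_netOfSubgroup hF hR hij]
    exact coe_mem_matrixSet.2 (hle (τ.elementary_mem hij ha))
  · refine DNet.group_mono fun i j hij a ha => ?_
    rw [mem_netOfSubgroup hF hR hij] at ha
    have ha' : elementary hij a ∈ F := coe_mem_matrixSet.1 ha
    obtain ⟨u, v, hv⟩ := hU
    obtain ⟨d, hd, hdval⟩ := diagonal_mem_matrixSet (le_refl (diagGroup n R)) _
      (isUnit_update (i := i) u.isUnit)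
    have hdτ := τ.diagGroup_le hd
    -- The diagonal element `d`, with `u` in position `i`, lies in `G(τ)`. Its conjugate by the
    -- transvection has entry `-(u - 1) a` at `(i, j)`, and `u - 1 = v` can be cancelled in the
    -- ideal.
    have hconj := hnorm.conj_mem ⟨d, hF hd⟩ (Subgroup.mem_subgroupOf.2 hdτ) ⟨_, ha'⟩
    have h1 := (Subgroup.mem_subgroupOf.1 hconj).1 i j
    have hval : ((elementary hij a * d * (elementary hij a)⁻¹ : GL (Fin n) R)).1 =
        diagonal (Function.update 1 i (u : R)) + single i j (-(v * a)) := by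
      change (1 + single i j a) * d.1 * (1 - single i j a) = _
      rw [show d.1 = _ from hdval, add_mul, one_mul, single_mul_diagonal,
        Function.update_of_ne (Ne.symm hij), Pi.one_apply, mul_one, mul_sub, mul_one, add_mul,
        diagonal_mul_single, single_mul_single_of_ne _ _ _ _ (Ne.symm hij), Function.update_self,
        add_zero, show -((v : R) * a) = a + -(u * a) by rw [hv]; noncomm_ring, single_add,
        ← single_neg]
      abel
    have h2 : (diagonal (Function.update 1 i (u : R)) + single i j (-(v * a)) :
        Matrix (Fin n) (Fin n) R) i j ∈ τ.ideal i j := by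
      rw [← hval]
      exact h1
    rw [Matrix.add_apply, diagonal_apply_ne _ hij, zero_add, single_apply_same, neg_mem_iff] at h2
    have h3 := (τ.ideal i j).mul_mem_left ↑v⁻¹ _ h2
    rwa [v.inv_mul_cancel_left] at h3

/-- The net subgroup of `F` is normal in `F`. -/
theorem isNormalIn_netOfSubgroup {C : Type*} [CommRing C] [Algebra C R] {ι : Type} [Fintype ι]
    {e : ι → R} (he : CompleteOrthogonalIdempotents e) (hl : ∀ s, LocalIdem C (e s))
    {F : Subgroup (GL (Fin n) R)} (hF : diagGroup n R ≤ F) (hR : UnitGenerated R) :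
    IsNormalIn (netOfSubgroup hF hR).group F := by
  have D := diagonalFrame_matrixSet he hl hF
  have hiff := fun g : Matrix (Fin n) (Fin n) R => netEntries_iff (F := F) hF he hR (g := g)
  refine ⟨fun g hg => ?_, ⟨fun g hg a => ?_⟩⟩
  · rw [← coe_mem_matrixSet]
    exact D.mem_of_netEntries g.mul_inv g.inv_mul ((hiff _).2 hg.1) ((hiff _).2 hg.2)
  · rw [Subgroup.mem_subgroupOf] at hg ⊢
    have ha := coe_mem_matrixSet.2 a.2
    have hinv : (a : GL (Fin n) R).1 * ((a : GL (Fin n) R)⁻¹).1 = 1 := Units.mul_inv _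
    refine ⟨(hiff _).1 (D.netEntries_conj ha hinv ((hiff _).2 hg.1)), ?_⟩
    have h := (hiff _).1 (D.netEntries_conj ha hinv ((hiff _).2 hg.2))
    have heq : ((a * g * a⁻¹ : F) : GL (Fin n) R)⁻¹ = a.1 * (g : GL (Fin n) R)⁻¹ * a.1⁻¹ := by
      push_cast
      group
    rw [heq]
    exact h

end NormalNet

end LatticeGalois

theorem theorem10p5 (n : ℕ) (R : Type*) [Ring R] [IsArtinian Rᵐᵒᵖ R]
    (hR : ∀ m : Ideal (Subring.center R), m.IsMaximal → 7 ≤ ENat.card (Subring.center R ⧸ m)) :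
    (∀ F : Subgroup (Matrix.GeneralLinearGroup (Fin n) R), LatticeGalois.diagGroup n R ≤ F →
      ∃! c : Quotient (LatticeGalois.equivSetoid (LatticeGalois.glAction n R)
          (LatticeGalois.coordLattice n R)),
        ∀ M : LatticeGalois.SublatticesOfPrime (LatticeGalois.glAction n R)
          (LatticeGalois.coordLattice n R),
          Quotient.mk _ M = c →
            LatticeGalois.IsNormalIn
              (LatticeGalois.fixingGroup (LatticeGalois.glAction n R) M.1) F) ∧
    (∀ F : Subgroup (Matrix.GeneralLinearGroup (Fin n) R),
      LatticeGalois.IsClosedSubgroup (LatticeGalois.glAction n R)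
          (LatticeGalois.coordLattice n R) F ↔
        ∃ σ : LatticeGalois.DNet n R, F = σ.group) ∧
    (∀ S : Set (LatticeGalois.RightSubmodules n R),
      (∃ M : Sublattice (LatticeGalois.RightSubmodules n R),
        LatticeGalois.IsClosedSublattice (LatticeGalois.glAction n R)
          (LatticeGalois.coordLattice n R) M ∧ (M : Set (LatticeGalois.RightSubmodules n R)) = S) ↔
        ∃ σ : LatticeGalois.DNet n R, S = σ.lattice) := by
  obtain ⟨ι, _, e, he, hl⟩ := LatticeGalois.exists_complete_nilOrUnit (R := R)
  have hloc : ∀ s, LatticeGalois.LocalIdem (Subring.center R) (e s) := fun s =>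
    LatticeGalois.localIdem_of_center (he.idem s) (hl s).1 (hl s).2 hR
  have D := LatticeGalois.diagonalFrame_isUnit he hloc
  have hgen : LatticeGalois.UnitGenerated R := D.mem_of_units_subset
  have hU : LatticeGalois.HasConsecutiveUnits R := by
    obtain ⟨u, v, huv, -⟩ := D.exists_unit_sub_one
    exact ⟨u, v, huv⟩
  refine ⟨fun F hF => ?_, LatticeGalois.isClosedSubgroup_iff hgen hU,
    LatticeGalois.isClosedSublattice_iff hgen hU⟩
  have hfix := LatticeGalois.fixingGroup_primeFixed_group hgen hU
    (LatticeGalois.netOfSubgroup hF hgen)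
  -- The class is represented by `L₀'(G(σ))` for the net `σ` of `F`; its fixing group is `G(σ)`
  -- because net subgroups are closed.
  refine ⟨Quotient.mk _ ⟨LatticeGalois.primeFixed _ _ (LatticeGalois.netOfSubgroup hF hgen).group,
    inf_le_left⟩, fun M hM => ?_, fun c hc => ?_⟩
  · have h := Quotient.exact hM
    change LatticeGalois.fixingGroup _ M.1 = LatticeGalois.fixingGroup _ _ at h
    rw [h, hfix]
    exact LatticeGalois.isNormalIn_netOfSubgroup he hloc hF hgen
  · induction c using Quotient.inductionOn with
    | h M =>
      refine Quotient.sound ?_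
      have hM := hc M rfl
      have hnet := LatticeGalois.fixingGroup_eq_net hgen hU M.1 M.2
      rw [hnet] at hM
      exact (hnet.trans (LatticeGalois.group_eq_of_isNormalIn hF hgen hU hM)).trans hfix.symm
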